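/- Let $X$ be a connected complex manifold (for instance $X=\mathbb{P}^1(\mathbb{C})\setminus\{0,1,\infty\}$) and let $(E_{\mathbb R},D,Q,\ E_{\mathbb C}=E^0\oplus E^1\oplus E^2\oplus E^3)$ be a family of real Hodge structures of weight $3$ and type $(1,1,1,1)$ over $X$. That is: $E_{\mathbb R}$ is a flat real vector bundle of rank $4$ over $X$ with complexification $E_{\mathbb C}$; $Q$ is a flat symplectic form on $E_{\mathbb R}$; the $E^p$ are complex line bundles with $\overline{E^p}=E^{3-p}$; the decomposition is orthogonal for the Hermitian form $h(u,v)=i\,Q_{\mathbb C}(u,\bar v)$, which is positive definite on $E^p$ for $p$ even and negative definite for $p$ odd; and the subbundles $F^p=\bigoplus_{q\ge p}E^q$ of $E_{\mathbb C}$ are holomorphic. Let $\mathrm{Gr}(2,E_{\mathbb C})$ be the bundle over $X$ of complex $2$-planes in the fibres of $E_{\mathbb C}$, with its usual topology and with the foliation induced by the flat structure (two points lie on the same leaf if and only if one is obtained from the other by parallel transport along a path in $X$). A subset of it is called invariant if it is a union of leaves. Let $\mathcal{M}\subset \mathrm{Gr}(2,E_{\mathbb C})$ be the set of $2$-planes that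 are real (stable under complex conjugation) and isotropic for $Q_{\mathbb C}$, and let $\mathcal{M}_x$ be its part over $x\in X$. For $x \in X$, let $\Gamma_x\subset \mathrm{GL}(E_{\mathbb R,x})$ be the image of the monodromy representation of $\pi_1(X,x)$. Suppose that, for some $x_0\in X$ and some symplectic basis of $(E_{\mathbb R,x_0},Q_{x_0})$, the group $\Gamma_{x_0}$ is contained in the group $\mathrm{Sp}(4,\mathbb{Z})$ of automorphisms of $(E_{\mathbb R,x_0},Q_{x_0})$ that preserve the lattice generated by this basis, and that it has finite index in it (the representation is thick). Then: 1. for every $x\in X$ and every $P\in\mathcal{M}_x$, the orbit $\Gamma_x\cdot P$ is contained and dense in $\mathcal{M}_x$; 2. $\mathcal{M}$ is a closed invariant subset of $\mathrm{Gr}(2,E_{\mathbb C})$, and every non-empty closed invariant subset of $\mathrm{Gr}(2,E_{\mathbb C})$ contained in $\mathcal{M}$ is equal to $\mathcal{M}$. -/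

import Mathlib

open Topology Bundle TensorProduct Manifold Filter
open scoped unitInterval

noncomputable section

/-! ### Flat vector bundles, parallel transport and monodromy -/

/-- A flat structure on a real vector bundle `E → X` of rank `n`: a family of local trivializations
of the bundle (the flat ones, i.e. those given by frames of flat sections) whose domains cover `X`
and whose transition functions are locally constant. -/
structure FlatStructure {X : Type*} [TopologicalSpace X] (n : ℕ) (E : X → Type*)
    [∀ x, AddCommGroup (E x)] [∀ x, Module ℝ (E x)] [∀ x, TopologicalSpace (E x)]
    [TopologicalSpace (TotalSpace (Fin n → ℝ) E)] [FiberBundle (Fin n → ℝ) E]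
    [VectorBundle ℝ (Fin n → ℝ) E] where
  charts : Set (Trivialization (Fin n → ℝ) (π (Fin n → ℝ) E))
  linear : ∀ e : charts, e.1.IsLinear ℝ
  exists_chart : ∀ x : X, ∃ e ∈ charts, x ∈ e.baseSet
  locally_constant : ∀ e ∈ charts, ∀ e' ∈ charts, ∀ x ∈ e.baseSet ∩ e'.baseSet,
    ∀ᶠ y in 𝓝 x, e.coordChange e' y = e.coordChange e' x

attribute [instance] FlatStructure.linear

namespace FlatStructure

variable {X : Type*} [TopologicalSpace X] {n : ℕ} {E : X → Type*}
  [∀ x, AddCommGroup (E x)] [∀ x, Module ℝ (E x)] [∀ x, TopologicalSpace (E x)]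
  [TopologicalSpace (TotalSpace (Fin n → ℝ) E)] [FiberBundle (Fin n → ℝ) E]
  [VectorBundle ℝ (Fin n → ℝ) E]

/-- A curve in the total space of `E` is parallel if its coordinates in every flat trivialization
are locally constant. -/
def IsParallel (A : FlatStructure n E) (τ : I → TotalSpace (Fin n → ℝ) E) : Prop :=
  ∀ t₀ : I, ∀ e ∈ A.charts, (τ t₀).proj ∈ e.baseSet → ∀ᶠ t in 𝓝 t₀, (e (τ t)).2 = (e (τ t₀)).2

/-- `T : E x → E y` is the parallel transport along the path `γ` from `x` to `y`: every `v` in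
`E x` is joined to `T v` by a parallel curve lying over `γ`. -/
def IsParallelTransport (A : FlatStructure n E) {x y : X} (γ : Path x y) (T : E x ≃ₗ[ℝ] E y) :
    Prop :=
  ∀ v : E x, ∃ τ : I → TotalSpace (Fin n → ℝ) E, (∀ t, (τ t).proj = γ t) ∧ A.IsParallel τ ∧
    τ 0 = ⟨x, v⟩ ∧ τ 1 = ⟨y, T v⟩

theorem IsParallelTransport.refl (A : FlatStructure n E) (x : X) :
    A.IsParallelTransport (Path.refl x) (LinearEquiv.refl ℝ (E x)) := fun v =>
  ⟨fun _ => ⟨x, v⟩, fun _ => rfl, fun _ _ _ _ => Eventually.of_forall fun _ => rfl, rfl, rfl⟩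

theorem IsParallelTransport.symm {A : FlatStructure n E} {x y : X} {γ : Path x y}
    {T : E x ≃ₗ[ℝ] E y} (h : A.IsParallelTransport γ T) :
    A.IsParallelTransport γ.symm T.symm := by
  intro v
  obtain ⟨τ, h1, h2, h3, h4⟩ := h (T.symm v)
  refine ⟨fun t => τ (unitInterval.symm t), fun t => h1 _, fun t₀ e he hx => ?_, ?_, ?_⟩
  · exact (unitInterval.continuous_symm.tendsto t₀).eventually (h2 _ e he hx)
  · simpa using h4
  · simpa using h3

theorem IsParallelTransport.trans {A : FlatStructure n E} {x y z : X} {γ : Path x y}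
    {γ' : Path y z} {T : E x ≃ₗ[ℝ] E y} {T' : E y ≃ₗ[ℝ] E z} (h : A.IsParallelTransport γ T)
    (h' : A.IsParallelTransport γ' T') :
    A.IsParallelTransport (γ.trans γ') (T.trans T') := by
  intro v
  obtain ⟨τ, h1, h2, h3, h4⟩ := h v
  obtain ⟨τ', h1', h2', h3', h4'⟩ := h' (T v)
  let a : I → I := fun t => Set.projIcc 0 1 zero_le_one (2 * (t : ℝ))
  let c : I → I := fun t => Set.projIcc 0 1 zero_le_one (2 * (t : ℝ) - 1)
  have ha : Continuous a := continuous_projIcc.comp (by fun_prop)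
  have hc : Continuous c := continuous_projIcc.comp (by fun_prop)
  have ha1 : ∀ t : I, (t : ℝ) = 1 / 2 → a t = 1 := fun t ht => by
    simp only [a, ht]; exact Set.projIcc_of_right_le _ (by norm_num)
  have hc0 : ∀ t : I, (t : ℝ) = 1 / 2 → c t = 0 := fun t ht => by
    simp only [c, ht]; exact Set.projIcc_of_le_left _ (by norm_num)
  have hmid : ∀ t : I, (t : ℝ) = 1 / 2 → τ (a t) = τ' (c t) := fun t ht => by
    rw [ha1 t ht, hc0 t ht, h4, h3']
  refine ⟨fun t => if (t : ℝ) ≤ 1 / 2 then τ (a t) else τ' (c t), fun t => ?_,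
    fun t₀ e he hx => ?_, ?_, ?_⟩
  · rw [Path.trans_apply]
    split_ifs with ht
    · simp only [ht, if_true]
      refine (h1 _).trans (congrArg γ ?_)
      exact Set.projIcc_of_mem _ _
    · simp only [ht, if_false]
      refine (h1' _).trans (congrArg γ' ?_)
      exact Set.projIcc_of_mem _ _
  · rcases lt_trichotomy (t₀ : ℝ) (1 / 2) with ht | ht | ht
    · simp only [ht.le, if_true] at hx ⊢
      filter_upwards [(ha.tendsto t₀).eventually (h2 _ e he hx),
        continuous_subtype_val.continuousAt.eventually_lt continuousAt_const ht] with t h5 h6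
      have h6 : (t : ℝ) ≤ 1 / 2 := h6.le
      simp only [h6, if_true]
      exact h5
    · simp only [ht, le_refl, if_true] at hx ⊢
      have hx' := hx
      rw [hmid t₀ ht] at hx'
      filter_upwards [(ha.tendsto t₀).eventually (h2 _ e he hx),
        (hc.tendsto t₀).eventually (h2' _ e he hx')] with t h5 h6
      split_ifs
      · exact h5
      · rw [hmid t₀ ht]
        exact h6
    · simp only [not_le.2 ht, if_false] at hx ⊢
      filter_upwards [(hc.tendsto t₀).eventually (h2' _ e he hx),
        continuousAt_const.eventually_lt continuous_subtype_val.continuousAt ht] with t h5 h6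
      have h6 : ¬ (t : ℝ) ≤ 1 / 2 := not_le.2 h6
      simp only [h6, if_false]
      exact h5
  · have : a 0 = 0 := by
      simp only [a]; exact Set.projIcc_of_le_left _ (by norm_num)
    simp [this, h3]
  · have : c 1 = 1 := by
      simp only [c]; exact Set.projIcc_of_right_le _ (by norm_num)
    have h7 : ¬ (1 : ℝ) ≤ 2⁻¹ := by norm_num
    simp [this, h4', h7]

/-- The monodromy group at `x`, i.e. the image of the monodromy representation of `π₁(X, x)`:
all parallel transports along loops based at `x`. -/
def monodromyGroup (A : FlatStructure n E) (x : X) : Subgroup (E x ≃ₗ[ℝ] E x) where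
  carrier := {T | ∃ γ : Path x x, A.IsParallelTransport γ T}
  one_mem' := ⟨Path.refl x, IsParallelTransport.refl A x⟩
  mul_mem' := by
    rintro S T ⟨γ, h⟩ ⟨γ', h'⟩
    exact ⟨γ'.trans γ, h'.trans h⟩
  inv_mem' := by
    rintro T ⟨γ, h⟩
    exact ⟨γ.symm, h.symm⟩

/-- The complexification `ℂ ⊗ E x ≃ ℂⁿ` of the linear isomorphism `E x ≃ ℝⁿ` given by a flat
trivialization. -/
def complexFrame (A : FlatStructure n E) (e : A.charts) (x : X) (hx : x ∈ e.1.baseSet) :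
    (ℂ ⊗[ℝ] E x) ≃ₗ[ℂ] (Fin n → ℂ) :=
  ((e.1.linearEquivAt ℝ x hx).baseChange ℝ ℂ (E x) (Fin n → ℝ)).trans
    (TensorProduct.piScalarRight ℝ ℂ ℂ (Fin n))

/-- A bilinear form on the fibres is flat if its coefficients in flat trivializations are locally
constant. -/
def IsFlatForm (A : FlatStructure n E) (Q : ∀ x, LinearMap.BilinForm ℝ (E x)) : Prop :=
  ∀ e ∈ A.charts, ∀ x ∈ e.baseSet, ∀ᶠ y in 𝓝 x, ∀ u v : Fin n → ℝ,
    Q y (e.symm y u) (e.symm y v) = Q x (e.symm x u) (e.symm x v)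

/-- A family of complex subspaces of the fibres of `E_ℂ = ℂ ⊗ E` is a holomorphic subbundle, for
the holomorphic structure of `E_ℂ` in which flat frames are holomorphic: in flat trivializations,
it has local holomorphic frames. -/
def IsHolomorphicSubbundle {H : Type*} [NormedAddCommGroup H] [NormedSpace ℂ H] [ChartedSpace H X]
    (A : FlatStructure n E) (S : ∀ x, Submodule ℂ (ℂ ⊗[ℝ] E x)) : Prop :=
  ∀ (e : A.charts) (x₀ : X), x₀ ∈ e.1.baseSet → ∃ (k : ℕ) (s : X → Fin k → Fin n → ℂ) (U : Set X),
    IsOpen U ∧ x₀ ∈ U ∧ U ⊆ e.1.baseSet ∧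
    MDifferentiableOn 𝓘(ℂ, H) 𝓘(ℂ, Fin k → Fin n → ℂ) s U ∧
    ∀ (x : X) (hx : x ∈ e.1.baseSet), x ∈ U → LinearIndependent ℂ (s x) ∧
      (S x).map (A.complexFrame e x hx).toLinearMap = Submodule.span ℂ (Set.range (s x))

end FlatStructure

/-! ### Real Hodge structures -/

/-- Complex conjugation on the complexification of a real vector space. -/
def complexConj (V : Type*) [AddCommGroup V] [Module ℝ V] : (ℂ ⊗[ℝ] V) →ₗ[ℝ] (ℂ ⊗[ℝ] V) :=
  LinearMap.rTensor V Complex.conjAe.toLinearMap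

/-- The form `h(u, v) = ε Q_ℂ(u, v̄)`, with `ε = 1` if `w` is even and `ε = i` if `w` is odd. -/
def hodgeForm {V : Type*} [AddCommGroup V] [Module ℝ V] (w : ℕ) (Q : LinearMap.BilinForm ℝ V)
    (u v : ℂ ⊗[ℝ] V) : ℂ :=
  (if Even w then 1 else Complex.I) * Q.baseChange ℂ u (complexConj V v)

/-- A family of real Hodge structures of weight `w` on the flat bundle `E` over `X`; `H x p` is the
fibre at `x` of `E^p`. -/
structure RealHodgeFamily (M : Type*) [NormedAddCommGroup M] [NormedSpace ℂ M]
    {X : Type*} [TopologicalSpace X] [ChartedSpace M X] {n : ℕ} {E : X → Type*}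
    [∀ x, AddCommGroup (E x)] [∀ x, Module ℝ (E x)] [∀ x, TopologicalSpace (E x)]
    [TopologicalSpace (TotalSpace (Fin n → ℝ) E)] [FiberBundle (Fin n → ℝ) E]
    [VectorBundle ℝ (Fin n → ℝ) E] (A : FlatStructure n E) (w : ℕ) where
  Q : ∀ x, LinearMap.BilinForm ℝ (E x)
  flat : A.IsFlatForm Q
  nondegenerate : ∀ x, (Q x).Nondegenerate
  symm : Even w → ∀ x, (Q x).IsSymm
  alt : Odd w → ∀ x, (Q x).IsAlt
  H : ∀ x, Fin (w + 1) → Submodule ℂ (ℂ ⊗[ℝ] E x)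
  isInternal : ∀ x, DirectSum.IsInternal (H x)
  conj_mem : ∀ x p, ∀ v, complexConj (E x) v ∈ H x p.rev ↔ v ∈ H x p
  orthogonal : ∀ x p q, p ≠ q → ∀ u ∈ H x p, ∀ v ∈ H x q, hodgeForm w (Q x) u v = 0
  pos : ∀ x (p : Fin (w + 1)), Even (p : ℕ) → ∀ v ∈ H x p, v ≠ 0 →
    0 < (hodgeForm w (Q x) v v).re
  neg : ∀ x (p : Fin (w + 1)), Odd (p : ℕ) → ∀ v ∈ H x p, v ≠ 0 →
    (hodgeForm w (Q x) v v).re < 0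
  holomorphic : ∀ p : Fin (w + 1),
    A.IsHolomorphicSubbundle (H := M) fun x => ⨆ q : Fin (w + 1), ⨆ _ : p ≤ q, H x q

/-! ### The integral symplectic group -/

/-- `b` is a symplectic basis for `Q`: its Gram matrix is the standard symplectic matrix. -/
def IsSymplecticBasis {V : Type*} [AddCommGroup V] [Module ℝ V] (Q : LinearMap.BilinForm ℝ V)
    (b : Module.Basis (Fin 2 ⊕ Fin 2) ℝ V) : Prop :=
  ∀ i j, Q (b i) (b j) = Matrix.J (Fin 2) ℝ i j

/-- The group `Sp(V, ℤ)` of automorphisms of `V` that preserve `Q` and the lattice `V_ℤ` generated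
by `b`. If `b` is a symplectic basis, it is `Sp(4, ℤ)` in the coordinates given by `b`. -/
def integralSymplecticGroup {V : Type*} [AddCommGroup V] [Module ℝ V]
    (Q : LinearMap.BilinForm ℝ V) (b : Module.Basis (Fin 2 ⊕ Fin 2) ℝ V) :
    Subgroup (V ≃ₗ[ℝ] V) where
  carrier := {g | (∀ u v, Q (g u) (g v) = Q u v) ∧
    ∀ v, g v ∈ Submodule.span ℤ (Set.range b) ↔ v ∈ Submodule.span ℤ (Set.range b)}
  one_mem' := ⟨fun _ _ => rfl, fun _ => Iff.rfl⟩
  mul_mem' := by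
    rintro g h ⟨hg, hg'⟩ ⟨hh, hh'⟩
    exact ⟨fun u v => (hg _ _).trans (hh _ _), fun v => (hg' _).trans (hh' _)⟩
  inv_mem' := by
    rintro g ⟨hg, hg'⟩
    refine ⟨fun u v => ?_, fun v => ?_⟩
    · have := hg (g.symm u) (g.symm v)
      simpa using this.symm
    · have := hg' (g.symm v)
      simpa using this.symm

/-! ### Grassmannians and Grassmann bundles -/

/-- The Grassmannian of `k`-dimensional complex subspaces of `V`. -/
def Gr (k : ℕ) (V : Type*) [AddCommGroup V] [Module ℂ V] : Type _ :=
  {P : Submodule ℂ V // Module.finrank ℂ P = k}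

/-- The image of a `k`-plane under a linear isomorphism. -/
def Gr.map {k : ℕ} {V W : Type*} [AddCommGroup V] [Module ℂ V] [AddCommGroup W] [Module ℂ W]
    (f : V ≃ₗ[ℂ] W) (P : Gr k V) : Gr k W :=
  ⟨P.1.map f.toLinearMap, (LinearEquiv.finrank_map_eq f P.1).trans P.2⟩

/-- The `k`-plane spanned by a `k`-frame. -/
def Gr.ofFrame {k : ℕ} {V : Type*} [AddCommGroup V] [Module ℂ V]
    (v : {v : Fin k → V // LinearIndependent ℂ v}) : Gr k V :=
  ⟨Submodule.span ℂ (Set.range v.1), by simpa using finrank_span_eq_card v.2⟩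

/-- The usual topology of the Grassmannian of `ℂⁿ`, as a quotient of the space of `k`-frames. -/
instance {k n : ℕ} : TopologicalSpace (Gr k (Fin n → ℂ)) :=
  TopologicalSpace.coinduced Gr.ofFrame inferInstance

namespace FlatStructure

variable {X : Type*} [TopologicalSpace X] {n : ℕ} {E : X → Type*}
  [∀ x, AddCommGroup (E x)] [∀ x, Module ℝ (E x)] [∀ x, TopologicalSpace (E x)]
  [TopologicalSpace (TotalSpace (Fin n → ℝ) E)] [FiberBundle (Fin n → ℝ) E]
  [VectorBundle ℝ (Fin n → ℝ) E]

/-- The total space of the Grassmann bundle `Gr(k, E_ℂ)` of the complexified bundle. -/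
def GrBundle (_A : FlatStructure n E) (k : ℕ) : Type _ :=
  Σ x : X, Gr k (ℂ ⊗[ℝ] E x)

/-- The local parametrization `U × Gr(k, ℂⁿ) → Gr(k, E_ℂ)` given by a flat trivialization over
`U`. -/
def grParam (A : FlatStructure n E) (k : ℕ) (e : A.charts)
    (p : e.1.baseSet × Gr k (Fin n → ℂ)) : A.GrBundle k :=
  ⟨p.1.1, p.2.map (A.complexFrame e p.1.1 p.1.2).symm⟩

/-- The topology of the Grassmann bundle, glued from the products `U × Gr(k, ℂⁿ)`. -/
instance (A : FlatStructure n E) (k : ℕ) : TopologicalSpace (A.GrBundle k) :=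
  ⨆ e : A.charts, TopologicalSpace.coinduced (A.grParam k e) inferInstance

/-- The image of a `k`-plane of `ℂ ⊗ E x` under a real linear isomorphism `E x → E y`. -/
def transportPlane (A : FlatStructure n E) {k : ℕ} {x y : X} (T : E x ≃ₗ[ℝ] E y)
    (P : Gr k (ℂ ⊗[ℝ] E x)) : A.GrBundle k :=
  ⟨y, P.map (T.baseChange ℝ ℂ (E x) (E y))⟩

/-- The leaf through a point of `Gr(k, E_ℂ)` of the foliation induced by the flat structure:
everything that is reached by parallel transport. -/
def leaf (A : FlatStructure n E) {k : ℕ} (P : A.GrBundle k) : Set (A.GrBundle k) :=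
  {R | ∃ (y : X) (γ : Path P.1 y) (T : E P.1 ≃ₗ[ℝ] E y),
    A.IsParallelTransport γ T ∧ R = A.transportPlane T P.2}

/-- A subset of `Gr(k, E_ℂ)` is invariant if it is a union of leaves. -/
def IsInvariant (A : FlatStructure n E) {k : ℕ} (S : Set (A.GrBundle k)) : Prop :=
  ∀ P ∈ S, A.leaf P ⊆ S

/-- The orbit of a `k`-plane in the fibre at `x` under the monodromy group at `x`. -/
def monodromyOrbit (A : FlatStructure n E) {k : ℕ} {x : X} (P : Gr k (ℂ ⊗[ℝ] E x)) :
    Set (A.GrBundle k) :=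
  {R | ∃ T ∈ A.monodromyGroup x, R = A.transportPlane T P}

/-- The set of `k`-planes of the fibres of `E_ℂ` that are real (stable under conjugation) and
isotropic for `Q`. -/
def realIsotropic (A : FlatStructure n E) (Q : ∀ x, LinearMap.BilinForm ℝ (E x)) (k : ℕ) :
    Set (A.GrBundle k) :=
  {P | (∀ v ∈ P.2.1, complexConj (E P.1) v ∈ P.2.1) ∧
    ∀ u ∈ P.2.1, ∀ v ∈ P.2.1, (Q P.1).baseChange ℂ u v = 0}

end FlatStructure

end

/-! Parallel transport commutes with conjugation and preserves `Q`, so the real isotropic planes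
form an invariant set, closed because it is so in each flat chart. A real isotropic plane is the
complexification of a Lagrangian plane, so the core is the density of a monodromy orbit among the
Lagrangian planes of one fibre.

Finite index puts a positive power of every integral transvection into the monodromy group. Let L =
⟨a, b⟩ be Lagrangian and v rational, with ω(v, b) = 0 and ω(v, a) ≠ 0. High powers of a transvection
along v fix b and send a to a plus a large multiple of v, so the images of L tend to ⟨v, b⟩. A
second rational vector w orthogonal to v then gives ⟨v, w⟩ (`mem_of_isRationalVector`). Thus the
orbit closure contains all rational Lagrangian planes, and these are dense (`mem_of_isotropic`).

Limits are taken among pairs of vectors rather than planes: K is the closure of the set of frames of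
planes in the orbit, and `continuous_realFrameSpan` carries the result back to the Grassmann bundle.
For minimality, a non-empty invariant set is transported into every fibre, where density applies. -/

/-! ### Lagrangian planes in a real symplectic space with a rational structure -/

section RationalTransvections

variable {ι : Type*} {ω : LinearMap.BilinForm ℝ (ι → ℝ)} {K : Set ((ι → ℝ) × (ι → ℝ))}

/-- The vectors with rational coordinates. -/
def IsRationalVector (v : ι → ℝ) : Prop := ∃ q : ι → ℚ, v = fun i => (q i : ℝ)

/-- A set of pairs of vectors that is invariant under changing the basis of the spanned plane. -/
def IsChangeOfBasisInvariant {V : Type*} [AddCommGroup V] [Module ℝ V] (K : Set (V × V)) : Prop :=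
  ∀ a b, (a, b) ∈ K → ∀ p q r s : ℝ, p * s ≠ q * r → (p • a + q • b, r • a + s • b) ∈ K

/-- A set of pairs of vectors that is, for every rational vector `v`, invariant under the positive
powers of some nontrivial transvection along `v`. -/
def IsTransvectionInvariant (ω : LinearMap.BilinForm ℝ (ι → ℝ))
    (K : Set ((ι → ℝ) × (ι → ℝ))) : Prop :=
  ∀ v, IsRationalVector v → ∃ c : ℝ, c ≠ 0 ∧ ∀ k : ℕ, ∀ a b, (a, b) ∈ K →
    (a + (k * c * ω v a) • v, b + (k * c * ω v b) • v) ∈ K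

theorem IsChangeOfBasisInvariant.swap {V : Type*} [AddCommGroup V] [Module ℝ V] {K : Set (V × V)}
    (hK : IsChangeOfBasisInvariant K) {a b : V} (h : (a, b) ∈ K) : (b, a) ∈ K := by
  simpa using hK a b h 0 1 1 0 (by norm_num)

/-- In a symplectic space of dimension four, a vector orthogonal to an isotropic plane lies in
it. -/
theorem mem_span_pair_of_orthogonal {V : Type*} [AddCommGroup V] [Module ℝ V]
    {ω : LinearMap.BilinForm ℝ V}
    (hdim : Module.finrank ℝ V = 4) (halt : ω.IsAlt) (hnd : ω.Nondegenerate)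
    {a b v : V} (hab : LinearIndependent ℝ ![a, b]) (h0 : ω a b = 0)
    (hva : ω v a = 0) (hvb : ω v b = 0) : v ∈ Submodule.span ℝ {a, b} := by
  have : FiniteDimensional ℝ V := Module.finite_of_finrank_pos (by omega)
  set L := Submodule.span ℝ {a, b} with hL
  have hLdim : Module.finrank ℝ L = 2 := by
    rw [hL, ← Matrix.range_cons_cons_empty a b ![]]
    exact finrank_span_eq_card hab
  have hz : ∀ x y, ω x y = 0 → ω y x = 0 := fun x y h => by
    have := halt.neg_eq x y
    rw [h, neg_zero] at this
    exact this.symm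
  have hle : L ≤ ω.orthogonal L := by
    refine Submodule.span_le.2 ?_
    intro x hx
    rw [SetLike.mem_coe, LinearMap.BilinForm.mem_orthogonal_iff]
    intro y hy
    obtain ⟨p, q, rfl⟩ := Submodule.mem_span_pair.1 hy
    have haa := halt a
    have hbb := halt b
    have hba := hz _ _ h0
    rcases hx with rfl | rfl <;> simp_all
  -- The plane and its orthogonal both have dimension 2 = 4 - 2, so the inclusion is an equality.
  have heq : L = ω.orthogonal L := by
    refine Submodule.eq_of_le_of_finrank_eq hle ?_
    rw [LinearMap.BilinForm.finrank_orthogonal hnd, hdim, hLdim]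
  rw [heq, LinearMap.BilinForm.mem_orthogonal_iff]
  intro y hy
  obtain ⟨p, q, rfl⟩ := Submodule.mem_span_pair.1 hy
  simp [hz _ _ hva, hz _ _ hvb]

/-- Applying high powers of the transvection along `v` to the plane spanned by `a` and `b`, where
`b` is orthogonal to `v`, replaces `a` by `v` in the limit. -/
theorem mem_of_transvection_limit (hK : IsClosed K) (hGL : IsChangeOfBasisInvariant K)
    (hT : IsTransvectionInvariant ω K) {a b v : ι → ℝ} (hv : IsRationalVector v)
    (hab : (a, b) ∈ K) (ha : ω v a ≠ 0) (hb : ω v b = 0) : (v, b) ∈ K := by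
  obtain ⟨c, hc, h⟩ := hT v hv
  -- The first vector is divided by (k + 1) c ω(v, a), the coefficient of v after the power k + 1;
  -- starting at 1 keeps this divisor nonzero.
  have hmem : ∀ k : ℕ, ((1 / ((k : ℝ) + 1)) • ((c * ω v a)⁻¹ • a) + v, b) ∈ K := fun k => by
    have h1 := hGL _ _ (h (k + 1) a b hab) (((k + 1 : ℕ) * c * ω v a)⁻¹) 0 0 1 (by
      simp only [mul_one, mul_zero]
      push_cast
      have : (k : ℝ) + 1 ≠ 0 := by positivity
      positivity)
    have h2 : (k : ℝ) + 1 ≠ 0 := by positivity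
    convert h1 using 2
    · rw [smul_add, smul_smul, smul_smul, inv_mul_cancel₀ (by push_cast; positivity), one_smul,
        zero_smul, add_zero]
      congr 2
      push_cast
      field_simp
    · simp [hb]
  refine hK.mem_of_tendsto (f := fun k : ℕ => ((1 / ((k : ℝ) + 1)) • ((c * ω v a)⁻¹ • a) + v, b))
    (b := atTop) ?_ (Eventually.of_forall hmem)
  refine Tendsto.prodMk_nhds ?_ tendsto_const_nhds
  have := (tendsto_one_div_add_atTop_nhds_zero_nat (𝕜 := ℝ)).smul_const ((c * ω v a)⁻¹ • a)
  simpa using this.add_const v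

/-- If `K` contains a basis of a Lagrangian plane, it contains a basis of a Lagrangian plane that
starts with any given rational vector. -/
theorem exists_mem_of_isRationalVector [Fintype ι] (hdim : Module.finrank ℝ (ι → ℝ) = 4) (halt : ω.IsAlt)
    (hnd : ω.Nondegenerate) (hK : IsClosed K) (hGL : IsChangeOfBasisInvariant K)
    (hT : IsTransvectionInvariant ω K) {a b v : ι → ℝ} (hv : IsRationalVector v) (hv0 : v ≠ 0)
    (hab : (a, b) ∈ K) (hli : LinearIndependent ℝ ![a, b]) (h0 : ω a b = 0) :
    ∃ b', (v, b') ∈ K ∧ LinearIndependent ℝ ![v, b'] ∧ ω v b' = 0 := by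
  -- When a is not orthogonal to v, subtracting from b its component along a gives a vector of the
  -- plane orthogonal to v, which survives the limit.
  have key : ∀ a b, (a, b) ∈ K → LinearIndependent ℝ ![a, b] → ω a b = 0 → ω v a ≠ 0 →
      ∃ b', (v, b') ∈ K ∧ LinearIndependent ℝ ![v, b'] ∧ ω v b' = 0 := by
    intro a b hab hli h0 hva
    have hb' : ω v (-(ω v b / ω v a) • a + b) = 0 := by
      simp only [map_add, map_smul, smul_eq_mul]
      field_simp
      ring
    refine ⟨-(ω v b / ω v a) • a + b, ?_, ?_, hb'⟩
    · refine mem_of_transvection_limit hK hGL hT hv (a := a) ?_ hva hb'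
      simpa using hGL a b hab 1 0 (-(ω v b / ω v a)) 1 (by norm_num)
    · rw [LinearIndependent.pair_iff]
      intro s t hst
      -- Pairing with a kills b' by isotropy and leaves s ω(v, a) = 0.
      have h1 := congrArg (fun x => ω x a) hst
      have hba : ω b a = 0 := by
        have := halt.neg_eq a b
        rw [h0, neg_zero] at this
        exact this.symm
      simp only [map_add, map_smul, LinearMap.add_apply, LinearMap.smul_apply, smul_eq_mul,
        halt a, hba, mul_zero, add_zero, map_zero, LinearMap.zero_apply, mul_eq_zero, hva,
        or_false] at h1
      subst h1
      rw [LinearIndependent.pair_iff] at hli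
      have := hli (t * -(ω v b / ω v a)) t (by rw [← hst]; simp [smul_smul])
      exact ⟨rfl, this.2⟩
  by_cases hva : ω v a = 0
  · by_cases hvb : ω v b = 0
    -- Here v already lies in the plane, and whichever of a, b is independent of it completes it to
    -- a basis.
    · obtain ⟨p, q, rfl⟩ := Submodule.mem_span_pair.1
        (mem_span_pair_of_orthogonal hdim halt hnd hli h0 hva hvb)
      by_cases hp : p = 0
      · subst hp
        have hq : q ≠ 0 := by rintro rfl; simp at hv0
        refine ⟨(1 : ℝ) • a + (0 : ℝ) • b, hGL a b hab _ _ _ _ (by simpa using hq.symm), ?_, ?_⟩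
        · rw [LinearIndependent.pair_add_smul_add_smul_iff]
          exact ⟨hli, by simpa using hq.symm⟩
        · simpa using hva
      · refine ⟨(0 : ℝ) • a + (1 : ℝ) • b, hGL a b hab _ _ _ _ (by simpa using hp), ?_, ?_⟩
        · rw [LinearIndependent.pair_add_smul_add_smul_iff]
          exact ⟨hli, by simpa using hp⟩
        · simpa using hvb
    · refine key b a (hGL.swap hab) (LinearIndependent.pair_symm_iff.1 hli) ?_ hvb
      have := halt.neg_eq a b
      rw [h0, neg_zero] at this
      exact this.symm
  · exact key a b hab hli h0 hva

/-- If `K` contains a basis of a Lagrangian plane, it contains all rational bases of rational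
Lagrangian planes. -/
theorem mem_of_isRationalVector [Fintype ι] (hdim : Module.finrank ℝ (ι → ℝ) = 4) (halt : ω.IsAlt)
    (hnd : ω.Nondegenerate) (hK : IsClosed K) (hGL : IsChangeOfBasisInvariant K)
    (hT : IsTransvectionInvariant ω K) {a b v w : ι → ℝ}
    (hab : (a, b) ∈ K) (hli : LinearIndependent ℝ ![a, b]) (h0 : ω a b = 0)
    (hv : IsRationalVector v) (hw : IsRationalVector w) (hvw : LinearIndependent ℝ ![v, w])
    (hvw0 : ω v w = 0) : (v, w) ∈ K := by
  have hv0 : v ≠ 0 := by simpa using hvw.ne_zero 0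
  obtain ⟨b', hb', hli', h0'⟩ :=
    exists_mem_of_isRationalVector hdim halt hnd hK hGL hT hv hv0 hab hli h0
  have hwv : ω w v = 0 := by
    have := halt.neg_eq v w
    rw [hvw0, neg_zero] at this
    exact this.symm
  -- Either w already lies in ⟨v, b'⟩ and a change of basis suffices, or transvections along w push
  -- b' to w while fixing v.
  by_cases hwb : ω w b' = 0
  · obtain ⟨p, q, rfl⟩ := Submodule.mem_span_pair.1
      (mem_span_pair_of_orthogonal hdim halt hnd hli' h0' hwv hwb)
    have hq : q ≠ 0 := by
      rintro rfl
      rw [LinearIndependent.pair_iff] at hvw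
      simpa using hvw (-p) 1 (by simp)
    simpa using hGL v b' hb' 1 0 p q (by simpa using hq)
  · exact hGL.swap (mem_of_transvection_limit hK hGL hT hw (hGL.swap hb') hwb hwv)

theorem exists_seq_isRationalVector [Countable ι] (a : ι → ℝ) :
    ∃ u : ℕ → ι → ℝ, (∀ n, IsRationalVector (u n)) ∧ Tendsto u atTop (𝓝 a) := by
  have hd : DenseRange (Pi.map fun (_ : ι) (q : ℚ) => (q : ℝ)) :=
    DenseRange.piMap fun _ => Rat.denseRange_cast
  obtain ⟨u, hu, hlim⟩ := mem_closure_iff_seq_limit.1 (hd a)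
  exact ⟨u, fun n => (hu n).imp fun q hq => hq.symm, hlim⟩

/-- If `K` contains a basis of a Lagrangian plane, it contains all bases of Lagrangian planes. -/
theorem mem_of_isotropic [Fintype ι] (hdim : Module.finrank ℝ (ι → ℝ) = 4) (halt : ω.IsAlt)
    (hnd : ω.Nondegenerate) (hQ : ∀ v w, IsRationalVector v → IsRationalVector w →
      ∃ q : ℚ, ω v w = q)
    (hK : IsClosed K) (hGL : IsChangeOfBasisInvariant K)
    (hT : IsTransvectionInvariant ω K) {a b v w : ι → ℝ}
    (hab : (a, b) ∈ K) (hli : LinearIndependent ℝ ![a, b]) (h0 : ω a b = 0)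
    (hvw : LinearIndependent ℝ ![v, w]) (hvw0 : ω v w = 0) : (v, w) ∈ K := by
  classical
  have hcont : Continuous fun p : (ι → ℝ) × (ι → ℝ) => ω p.1 p.2 := by
    have h1 : ∀ p : (ι → ℝ) × (ι → ℝ), ω p.1 p.2 =
        LinearMap.toContinuousLinearMap (LinearMap.toContinuousLinearMap.toLinearMap ∘ₗ ω) p.1 p.2 :=
      fun _ => rfl
    simp only [h1]
    fun_prop
  have hv0 : v ≠ 0 := by simpa using hvw.ne_zero 0
  -- This c serves to correct rational approximations to exactly isotropic pairs. It exists because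
  -- otherwise ω(v, ·) would vanish on the coordinate vectors.
  obtain ⟨c, hc, hvc⟩ : ∃ c, IsRationalVector c ∧ ω v c ≠ 0 := by
    by_contra! hcon
    refine hv0 (hnd.1 v fun y => ?_)
    have : ω v = 0 := LinearMap.pi_ext' fun i => LinearMap.ext_ring (by
      simpa using hcon (Pi.single i 1) ⟨Pi.single i 1, by
        ext j; by_cases h : j = i <;> simp [h]⟩)
    rw [this, LinearMap.zero_apply]
  obtain ⟨x, hx, hxlim⟩ := exists_seq_isRationalVector v
  obtain ⟨y, hy, hylim⟩ := exists_seq_isRationalVector w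
  have l1 : Tendsto (fun n => ω (x n) c) atTop (𝓝 (ω v c)) :=
    (hcont.tendsto (v, c)).comp (hxlim.prodMk_nhds tendsto_const_nhds)
  have l2 : Tendsto (fun n => ω (x n) (y n)) atTop (𝓝 0) := by
    rw [← hvw0]
    exact (hcont.tendsto (v, w)).comp (hxlim.prodMk_nhds hylim)
  -- The correction makes the second vector orthogonal to x n; it tends to 0 since ω(x n, y n) tends
  -- to ω(v, w) = 0. It stays rational because ω is rational on rational vectors.
  have l3 : Tendsto (fun n => y n - (ω (x n) (y n) / ω (x n) c) • c) atTop (𝓝 w) := by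
    simpa using hylim.sub ((l2.div l1 hvc).smul_const c)
  have l4 : Tendsto (fun n => ![x n, y n - (ω (x n) (y n) / ω (x n) c) • c]) atTop
      (𝓝 ![v, w]) := by
    rw [tendsto_pi_nhds]
    intro i
    fin_cases i
    · exact hxlim
    · exact l3
  refine hK.mem_of_tendsto (hxlim.prodMk_nhds l3) ?_
  filter_upwards [l4.eventually (isOpen_setOfPred_linearIndependent.mem_nhds hvw),
    l1.eventually_ne hvc] with n hn hn'
  refine mem_of_isRationalVector hdim halt hnd hK hGL hT hab hli h0 (hx n) ?_ hn ?_
  · obtain ⟨p, hp⟩ := hQ _ _ (hx n) (hy n)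
    obtain ⟨q, hq⟩ := hQ _ _ (hx n) hc
    obtain ⟨r, hr⟩ := hy n
    obtain ⟨s, hs⟩ := hc
    refine ⟨fun i => r i - (p / q) * s i, ?_⟩
    ext i
    rw [hp, hq, hr, hs]
    simp
  · simp only [map_sub, map_smul, smul_eq_mul]
    field_simp
    ring

end RationalTransvections

/-! ### Existence and properties of parallel transport -/

namespace FlatStructure

variable {X : Type*} [TopologicalSpace X] {n : ℕ} {E : X → Type*}
  [∀ x, AddCommGroup (E x)] [∀ x, Module ℝ (E x)] [∀ x, TopologicalSpace (E x)]
  [TopologicalSpace (TotalSpace (Fin n → ℝ) E)] [FiberBundle (Fin n → ℝ) E]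
  [VectorBundle ℝ (Fin n → ℝ) E]

/-- Inside one flat chart, transport keeps the coordinates constant. The curves are then parallel in
every other chart because the transition functions are locally constant. -/
theorem exists_isParallelTransport_of_forall_mem_baseSet (A : FlatStructure n E) (e : A.charts)
    {x y : X} (γ : Path x y) (hγ : ∀ t, γ t ∈ e.1.baseSet) :
    ∃ T : E x ≃ₗ[ℝ] E y, A.IsParallelTransport γ T := by
  have hx : x ∈ e.1.baseSet := by simpa using hγ 0
  have hy : y ∈ e.1.baseSet := by simpa using hγ 1
  -- The endpoints `γ 0 = x` and `γ 1 = y` are only propositional equalities, so points over them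
  -- have to be identified by rewriting the base.
  have hmk : ∀ (z w : X) (c : Fin n → ℝ), z = w → (⟨z, e.1.symm z c⟩ :
      TotalSpace (Fin n → ℝ) E) = ⟨w, e.1.symm w c⟩ := by
    rintro z _ c rfl
    rfl
  refine ⟨(e.1.linearEquivAt ℝ x hx).trans (e.1.linearEquivAt ℝ y hy).symm, fun v =>
    ⟨fun t => ⟨γ t, e.1.symm (γ t) (e.1 ⟨x, v⟩).2⟩, fun t => rfl, ?_, ?_, ?_⟩⟩
  · intro t₀ e' he' ht₀
    have hcoord : ∀ t, γ t ∈ e'.baseSet → (e' ⟨γ t, e.1.symm (γ t) (e.1 ⟨x, v⟩).2⟩).2 =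
        e.1.coordChange e' (γ t) (e.1 ⟨x, v⟩).2 := fun t _ => by
      have h1 := e.1.coordChange_apply_snd e'
        (p := ⟨γ t, e.1.symm (γ t) (e.1 ⟨x, v⟩).2⟩) (hγ t)
      rw [← h1]
      simp only [e.1.apply_mk_symm (hγ t)]
    have h2 := γ.continuous.continuousAt (x := t₀) |>.eventually
      (A.locally_constant e.1 e.2 e' he' (γ t₀) ⟨hγ t₀, ht₀⟩)
    have h3 := γ.continuous.continuousAt (x := t₀) |>.eventually
      (e'.open_baseSet.mem_nhds ht₀)
    filter_upwards [h2, h3] with t h4 h5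
    simp only [hcoord t h5, hcoord t₀ ht₀, h4]
  · exact (hmk _ _ _ γ.source).trans (congrArg (TotalSpace.mk x) (e.1.symm_apply_apply_mk hx v))
  · exact hmk _ _ _ γ.target

/-- The set of points reachable from `x` is clopen: each point has a neighbourhood, inside a flat
chart, all of whose points are joined to it by transport, in both directions. -/
theorem exists_isParallelTransport [ConnectedSpace X] [LocallyPathConnectedSpace X]
    (A : FlatStructure n E) (x y : X) :
    ∃ (γ : Path x y) (T : E x ≃ₗ[ℝ] E y), A.IsParallelTransport γ T := by
  have hloc : ∀ z : X, ∃ U ∈ 𝓝 z, ∀ w ∈ U,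
      ∃ (γ : Path z w) (T : E z ≃ₗ[ℝ] E w), A.IsParallelTransport γ T := by
    intro z
    obtain ⟨e, he, hz⟩ := A.exists_chart z
    obtain ⟨U, ⟨hU, hpc⟩, hUe⟩ :=
      (path_connected_basis z).mem_iff.1 (e.open_baseSet.mem_nhds hz)
    refine ⟨U, hU, fun w hw => ?_⟩
    obtain ⟨γ, hγ⟩ := hpc.joinedIn z (mem_of_mem_nhds hU) w hw
    exact ⟨γ, A.exists_isParallelTransport_of_forall_mem_baseSet ⟨e, he⟩ γ fun t => hUe (hγ t)⟩
  let S : Set X := {z | ∃ (γ : Path x z) (T : E x ≃ₗ[ℝ] E z), A.IsParallelTransport γ T}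
  have hS : IsClopen S := by
    refine ⟨⟨isOpen_iff_mem_nhds.2 fun z hz => ?_⟩, isOpen_iff_mem_nhds.2 fun z hz => ?_⟩
    · obtain ⟨U, hU, h⟩ := hloc z
      filter_upwards [hU] with w hw ⟨γ, T, hT⟩
      obtain ⟨γ', T', hT'⟩ := h w hw
      exact hz ⟨_, _, hT.trans hT'.symm⟩
    · obtain ⟨U, hU, h⟩ := hloc z
      obtain ⟨γ, T, hT⟩ := hz
      filter_upwards [hU] with w hw
      obtain ⟨γ', T', hT'⟩ := h w hw
      exact ⟨_, _, hT.trans hT'⟩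
  have := hS.eq_univ ⟨x, _, _, IsParallelTransport.refl A x⟩
  exact (this ▸ Set.mem_univ y : y ∈ S)

/-- The pairing of two parallel curves over the same path is a locally constant function on the unit
interval, hence constant. -/
theorem IsParallelTransport.apply_eq {A : FlatStructure n E}
    {Q : ∀ x, LinearMap.BilinForm ℝ (E x)} (hQ : A.IsFlatForm Q) {x y : X} {γ : Path x y}
    {T : E x ≃ₗ[ℝ] E y} (h : A.IsParallelTransport γ T) (u v : E x) :
    Q y (T u) (T v) = Q x u v := by
  obtain ⟨τ, h1, h2, h3, h4⟩ := h u
  obtain ⟨ρ, g1, g2, g3, g4⟩ := h v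
  have hp : ∀ t, (τ t).proj = (ρ t).proj := fun t => (h1 t).trans (g1 t).symm
  -- The two curves have propositionally equal base points, hence the cast of the second vector.
  let f : I → ℝ := fun t => Q (τ t).proj (τ t).2 (hp t ▸ (ρ t).2)
  have key : ∀ (p q : TotalSpace (Fin n → ℝ) E) (hpq : p.proj = q.proj)
      (e : A.charts), p.proj ∈ e.1.baseSet →
      Q p.proj p.2 (hpq ▸ q.2) = Q p.proj (e.1.symm p.proj (e.1 p).2)
        (e.1.symm p.proj (e.1 q).2) := by
    rintro ⟨p, a⟩ ⟨q, c⟩ hpq e hp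
    obtain rfl : p = q := hpq
    rw [e.1.symm_apply_apply_mk hp, e.1.symm_apply_apply_mk hp]
  have hsymm : ∀ (e : Trivialization (Fin n → ℝ) (π (Fin n → ℝ) E)) (z w : X), z = w → ∀ c d,
      Q z (e.symm z c) (e.symm z d) = Q w (e.symm w c) (e.symm w d) := by
    rintro e z _ rfl c d
    rfl
  have hf : IsLocallyConstant f := by
    rw [IsLocallyConstant.iff_eventually_eq]
    intro t₀
    obtain ⟨e, he, hx⟩ := A.exists_chart (τ t₀).proj
    have hx' : (ρ t₀).proj ∈ e.baseSet := hp t₀ ▸ hx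
    have hγx : γ t₀ ∈ e.baseSet := h1 t₀ ▸ hx
    have k1 := γ.continuous.continuousAt (x := t₀) |>.eventually (hQ e he (γ t₀) hγx)
    have k2 := γ.continuous.continuousAt (x := t₀) |>.eventually (e.open_baseSet.mem_nhds hγx)
    filter_upwards [h2 t₀ e he hx, g2 t₀ e he hx', k1, k2] with t m1 m2 m3 m4
    have m4' : (τ t).proj ∈ e.baseSet := (h1 t).symm ▸ m4
    simp only [f]
    rw [key _ _ (hp t) ⟨e, he⟩ m4', key _ _ (hp t₀) ⟨e, he⟩ hx]
    simp only [m1, m2]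
    exact (hsymm e _ _ (h1 t) _ _).trans ((m3 _ _).trans (hsymm e _ _ (h1 t₀) _ _).symm)
  have h01 : f 1 = f 0 := hf.apply_eq_of_preconnectedSpace 1 0
  have tr : ∀ (z : X) (p q : TotalSpace (Fin n → ℝ) E) (a c : E z) (hpq : p.proj = q.proj),
      p = ⟨z, a⟩ → q = ⟨z, c⟩ → Q p.proj p.2 (hpq ▸ q.2) = Q z a c := by
    rintro z p q a c hpq rfl rfl
    rfl
  rwa [show f 1 = _ from tr y _ _ _ _ (hp 1) h4 g4, show f 0 = _ from tr x _ _ _ _ (hp 0) h3 g3]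
    at h01

end FlatStructure

/-! ### Integral transvections -/

section Transvections

variable {V : Type*} [AddCommGroup V] [Module ℝ V]

theorem pow_transvection_apply {f : Module.Dual ℝ V} {v : V} (h : f v = 0) (k : ℕ) (x : V) :
    (LinearEquiv.transvection h ^ k) x = x + (k * f x) • v := by
  induction k with
  | zero => simp
  | succ k ih =>
    rw [pow_succ', LinearEquiv.mul_apply, ih, LinearEquiv.transvection.apply]
    simp only [map_add, map_smul, h, smul_zero, add_zero]
    push_cast
    module

theorem IsSymplecticBasis.exists_int {Q : LinearMap.BilinForm ℝ V}
    {b : Module.Basis (Fin 2 ⊕ Fin 2) ℝ V} (hb : IsSymplecticBasis Q b) (i j) :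
    ∃ k : ℤ, Q (b i) (b j) = k := by
  rw [hb]
  rcases i with i | i <;> rcases j with j | j <;> simp only [Matrix.J, Matrix.fromBlocks_apply₁₁,
    Matrix.fromBlocks_apply₁₂, Matrix.fromBlocks_apply₂₁, Matrix.fromBlocks_apply₂₂]
  · exact ⟨0, by simp⟩
  · exact ⟨-(if i = j then 1 else 0), by simp [Matrix.one_apply]⟩
  · exact ⟨if i = j then 1 else 0, by simp [Matrix.one_apply]⟩
  · exact ⟨0, by simp⟩

theorem IsSymplecticBasis.exists_int_of_mem_span {Q : LinearMap.BilinForm ℝ V}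
    {b : Module.Basis (Fin 2 ⊕ Fin 2) ℝ V} (hb : IsSymplecticBasis Q b) {u v : V}
    (hu : u ∈ Submodule.span ℤ (Set.range b)) (hv : v ∈ Submodule.span ℤ (Set.range b)) :
    ∃ k : ℤ, Q u v = k := by
  induction hu using Submodule.span_induction with
  | zero => exact ⟨0, by simp⟩
  | add x y _ _ hx hy =>
    obtain ⟨k, hk⟩ := hx
    obtain ⟨l, hl⟩ := hy
    exact ⟨k + l, by simp [hk, hl]⟩
  | smul a x _ hx =>
    obtain ⟨k, hk⟩ := hx
    exact ⟨a * k, by simp [← Int.cast_smul_eq_zsmul ℝ, hk]⟩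
  | mem x hx =>
    obtain ⟨i, rfl⟩ := hx
    induction hv using Submodule.span_induction with
    | zero => exact ⟨0, by simp⟩
    | add x y _ _ hx hy =>
      obtain ⟨k, hk⟩ := hx
      obtain ⟨l, hl⟩ := hy
      exact ⟨k + l, by simp [hk, hl]⟩
    | smul a x _ hx =>
      obtain ⟨k, hk⟩ := hx
      exact ⟨a * k, by simp [← Int.cast_smul_eq_zsmul ℝ, hk]⟩
    | mem x hx =>
      obtain ⟨j, rfl⟩ := hx
      exact hb.exists_int i j

theorem transvection_mem_integralSymplecticGroup {Q : LinearMap.BilinForm ℝ V} (hQ : Q.IsAlt)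
    {b : Module.Basis (Fin 2 ⊕ Fin 2) ℝ V} (hb : IsSymplecticBasis Q b) {v : V}
    (hv : v ∈ Submodule.span ℤ (Set.range b)) :
    LinearEquiv.transvection (hQ v) ∈ integralSymplecticGroup Q b := by
  have hmem : ∀ w ∈ Submodule.span ℤ (Set.range b),
      (Q v w) • v ∈ Submodule.span ℤ (Set.range b) := fun w hw => by
    obtain ⟨k, hk⟩ := hb.exists_int_of_mem_span hv hw
    rw [hk, Int.cast_smul_eq_zsmul]
    exact Submodule.smul_mem _ _ hv
  refine ⟨fun u w => ?_, fun w => ⟨fun hw => ?_, fun hw => ?_⟩⟩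
  · simp only [LinearEquiv.transvection.apply, map_add, map_smul, LinearMap.add_apply,
      LinearMap.smul_apply, smul_eq_mul, hQ v, ← hQ.neg_eq v u]
    ring
  -- Since Q(v, Tw) = Q(v, w), the vector w is recovered as Tw - Q(v, Tw) v, which lies in the
  -- lattice.
  · have h1 := hmem _ hw
    rw [LinearEquiv.transvection.apply, map_add, map_smul, hQ v, smul_zero, add_zero] at h1
    rw [LinearEquiv.transvection.apply] at hw
    simpa using Submodule.sub_mem _ hw h1
  · rw [LinearEquiv.transvection.apply]
    exact Submodule.add_mem _ hw (hmem w hw)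

end Transvections

/-! ### Real planes in the complexification -/

section Complexification

variable {V W : Type*} [AddCommGroup V] [Module ℝ V] [AddCommGroup W] [Module ℝ W]

theorem complexConj_tmul (z : ℂ) (v : V) :
    complexConj V (z ⊗ₜ v) = (starRingEnd ℂ z) ⊗ₜ v := rfl

theorem complexConj_smul (z : ℂ) (u : ℂ ⊗[ℝ] V) :
    complexConj V (z • u) = (starRingEnd ℂ z) • complexConj V u := by
  induction u with
  | zero => simp
  | add x y hx hy => simp [hx, hy]
  | tmul c v => simp [complexConj_tmul, TensorProduct.smul_tmul']

theorem complexConj_baseChange (T : V →ₗ[ℝ] W) (u : ℂ ⊗[ℝ] V) :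
    complexConj W (T.baseChange ℂ u) = T.baseChange ℂ (complexConj V u) := by
  induction u with
  | zero => simp
  | add x y hx hy => simp [hx, hy]
  | tmul c v => simp [complexConj_tmul]

theorem baseChange_bilinForm_baseChange {Q : LinearMap.BilinForm ℝ V}
    {Q' : LinearMap.BilinForm ℝ W} {T : V →ₗ[ℝ] W} (h : ∀ u v, Q' (T u) (T v) = Q u v)
    (u v : ℂ ⊗[ℝ] V) :
    Q'.baseChange ℂ (T.baseChange ℂ u) (T.baseChange ℂ v) = Q.baseChange ℂ u v := by
  induction u with
  | zero => simp
  | add x y hx hy => simp [hx, hy]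
  | tmul c u =>
    induction v with
    | zero => simp
    | add x y hx hy => rw [map_add, map_add, map_add, hx, hy]
    | tmul d v => simp [h]

theorem exists_eq_add_I_tmul (u : ℂ ⊗[ℝ] V) :
    ∃ a c : V, u = (1 : ℂ) ⊗ₜ a + Complex.I ⊗ₜ c := by
  induction u with
  | zero => exact ⟨0, 0, by simp⟩
  | add x y hx hy =>
    obtain ⟨a, c, rfl⟩ := hx
    obtain ⟨a', c', rfl⟩ := hy
    exact ⟨a + a', c + c', by simp only [TensorProduct.tmul_add]; abel⟩
  | tmul z v =>
    refine ⟨z.re • v, z.im • v, ?_⟩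
    rw [← TensorProduct.smul_tmul, ← TensorProduct.smul_tmul, ← TensorProduct.add_tmul]
    congr 1
    apply Complex.ext <;> simp

/-- The complex plane spanned by a pair of real vectors. -/
noncomputable def complexSpan (a b : V) : Submodule ℂ (ℂ ⊗[ℝ] V) :=
  Submodule.span ℂ {(1 : ℂ) ⊗ₜ[ℝ] a, (1 : ℂ) ⊗ₜ[ℝ] b}

theorem complexSpan_eq_span_range (a b : V) :
    complexSpan a b = Submodule.span ℂ (Set.range fun i => (1 : ℂ) ⊗ₜ[ℝ] (![a, b] i)) := by
  rw [complexSpan]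
  congr 1
  ext x
  simp [eq_comm]

theorem finrank_complexSpan {a b : V} (h : LinearIndependent ℝ ![a, b]) :
    Module.finrank ℂ (complexSpan a b) = 2 := by
  rw [complexSpan_eq_span_range]
  exact finrank_span_eq_card (Module.Flat.linearIndependent_one_tmul (S := ℂ) h)

theorem LinearIndependent.pair_map {a b : V} (h : LinearIndependent ℝ ![a, b]) (f : V ≃ₗ[ℝ] W) :
    LinearIndependent ℝ ![f a, f b] := by
  have h1 : ![f a, f b] = f.toLinearMap ∘ ![a, b] := by
    ext i
    fin_cases i <;> rfl
  rw [h1]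
  exact h.map' f.toLinearMap f.ker

theorem map_complexSpan (T : V →ₗ[ℝ] W) (a b : V) :
    (complexSpan a b).map (T.baseChange ℂ) = complexSpan (T a) (T b) := by
  simp [complexSpan, Submodule.map_span, Set.image_pair]

theorem complexSpan_changeOfBasis {a b : V} (h : LinearIndependent ℝ ![a, b]) {p q r s : ℝ}
    (hpq : p * s ≠ q * r) : complexSpan (p • a + q • b) (r • a + s • b) = complexSpan a b := by
  have : Module.Finite ℂ (complexSpan a b) :=
    Module.finite_of_finrank_pos (by rw [finrank_complexSpan h]; norm_num)
  refine Submodule.eq_of_le_of_finrank_eq (Submodule.span_le.2 ?_) ?_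
  · have hm : ∀ p q : ℝ, (1 : ℂ) ⊗ₜ[ℝ] (p • a + q • b) ∈ complexSpan a b := fun p q =>
      Submodule.mem_span_pair.2 ⟨p, q, by
        simp [TensorProduct.tmul_add, TensorProduct.smul_tmul']⟩
    rintro x (rfl | rfl) <;> exact hm _ _
  · rw [finrank_complexSpan h, finrank_complexSpan]
    exact (LinearIndependent.pair_add_smul_add_smul_iff _ _ _ _).2 ⟨h, hpq⟩

/-- A complex plane that is stable under conjugation is spanned by real vectors. -/
theorem exists_eq_complexSpan [FiniteDimensional ℝ V] {P : Submodule ℂ (ℂ ⊗[ℝ] V)} (hP : Module.finrank ℂ P = 2)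
    (hconj : ∀ v ∈ P, complexConj V v ∈ P) :
    ∃ a b : V, LinearIndependent ℝ ![a, b] ∧ P = complexSpan a b := by
  have hfin : Module.Finite ℂ P := Module.finite_of_finrank_pos (by omega)
  -- The real points of `P`; a real basis of `R` will be a complex basis of `P`.
  let R : Submodule ℝ V := (P.restrictScalars ℝ).comap (TensorProduct.mk ℝ ℂ V 1)
  have hR : ∀ v, v ∈ R ↔ (1 : ℂ) ⊗ₜ[ℝ] v ∈ P := fun _ => Iff.rfl
  -- The real and imaginary parts (u + ū)/2 and (u - ū)/(2i) stay in `P` by stability under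
  -- conjugation.
  have hspan : ∀ u ∈ P, ∃ a ∈ R, ∃ c ∈ R, u = (1 : ℂ) ⊗ₜ a + Complex.I ⊗ₜ c := by
    intro u hu
    obtain ⟨a, c, rfl⟩ := exists_eq_add_I_tmul u
    have h1 := hconj _ hu
    simp only [map_add, complexConj_tmul, map_one, Complex.conj_I] at h1
    refine ⟨a, ?_, c, ?_, rfl⟩
    · have h2 := P.smul_mem (2⁻¹ : ℂ) (P.add_mem hu h1)
      rw [hR]
      convert h2 using 1
      rw [TensorProduct.neg_tmul]
      module
    · have h2 := P.smul_mem (-Complex.I * 2⁻¹ : ℂ) (P.sub_mem hu h1)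
      rw [hR]
      convert h2 using 1
      rw [TensorProduct.neg_tmul, show ∀ x y : ℂ ⊗[ℝ] V, x + y - (x + -y) = (2 : ℂ) • y from
        fun x y => by module, smul_smul, TensorProduct.smul_tmul']
      congr 1
      simp
  let β := Module.finBasis ℝ R
  have hli : LinearIndependent ℝ fun i => (β i : V) :=
    β.linearIndependent.map' R.subtype (Submodule.ker_subtype R)
  have hPs : P = Submodule.span ℂ (Set.range fun i => (1 : ℂ) ⊗ₜ[ℝ] (β i : V)) := by
    refine le_antisymm (fun u hu => ?_) (Submodule.span_le.2 ?_)
    · have hm : ∀ a ∈ R, (1 : ℂ) ⊗ₜ[ℝ] a ∈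
          Submodule.span ℂ (Set.range fun i => (1 : ℂ) ⊗ₜ[ℝ] (β i : V)) := fun a ha => by
        have h2 : a = ∑ i, β.repr ⟨a, ha⟩ i • (β i : V) := by
          have h3 := congrArg R.subtype (β.sum_repr ⟨a, ha⟩)
          simp only [map_sum, map_smul, Submodule.subtype_apply] at h3
          exact h3.symm
        rw [h2, TensorProduct.tmul_sum]
        refine Submodule.sum_mem _ fun i _ => ?_
        rw [TensorProduct.tmul_smul]
        exact Submodule.smul_of_tower_mem _ _ (Submodule.subset_span ⟨i, rfl⟩)
      obtain ⟨a, ha, c, hc, rfl⟩ := hspan u hu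
      refine Submodule.add_mem _ (hm a ha) ?_
      have := Submodule.smul_mem _ Complex.I (hm c hc)
      simpa [TensorProduct.smul_tmul'] using this
    · rintro _ ⟨i, rfl⟩
      exact (β i).2
  -- Vectors independent over ℝ stay independent over ℂ after base change, so the real dimension of
  -- `R` is the complex dimension of `P`.
  have hcard : Module.finrank ℝ R = 2 := by
    have h1 := finrank_span_eq_card (Module.Flat.linearIndependent_one_tmul (S := ℂ) hli)
    rw [← hPs, hP] at h1
    simpa using h1.symm
  let β' := β.reindex (finCongr hcard)
  have hβ : ![(β' 0 : V), (β' 1 : V)] = fun i => (β' i : V) := by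
    ext i; fin_cases i <;> rfl
  refine ⟨β' 0, β' 1, ?_, ?_⟩
  · rw [hβ]
    exact β'.linearIndependent.map' R.subtype (Submodule.ker_subtype R)
  · rw [complexSpan_eq_span_range, hβ, hPs]
    congr 1
    rw [← (finCongr hcard).surjective.range_comp]
    congr 1
    ext i
    simp [β']

end Complexification

/-! ### Closedness of the real isotropic locus in a Grassmannian -/

theorem Gr.continuous_ofFrame {k n : ℕ} :
    Continuous (Gr.ofFrame : {v : Fin k → Fin n → ℂ // LinearIndependent ℂ v} → Gr k (Fin n → ℂ)) :=
  continuous_coinduced_rng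

/-- The complex subspaces that are stable under conjugation and isotropic. -/
def IsRealIsotropic {V : Type*} [AddCommGroup V] [Module ℝ V] (Q : LinearMap.BilinForm ℝ V)
    (P : Submodule ℂ (ℂ ⊗[ℝ] V)) : Prop :=
  (∀ v ∈ P, complexConj V v ∈ P) ∧ ∀ u ∈ P, ∀ v ∈ P, Q.baseChange ℂ u v = 0

/-- Conjugation is semilinear and the form bilinear, so both conditions need only be tested on a
frame, where they can be read in coordinates. -/
theorem isRealIsotropic_map_symm_span_range_iff {V : Type*} [AddCommGroup V] [Module ℝ V]
    {Q : LinearMap.BilinForm ℝ V} {k n : ℕ} (φ : (ℂ ⊗[ℝ] V) ≃ₗ[ℂ] (Fin n → ℂ))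
    (v : Fin k → Fin n → ℂ) :
    IsRealIsotropic Q ((Submodule.span ℂ (Set.range v)).map φ.symm.toLinearMap) ↔
      (∀ i, φ (complexConj V (φ.symm (v i))) ∈ Submodule.span ℂ (Set.range v)) ∧
      ∀ i j, Q.baseChange ℂ (φ.symm (v i)) (φ.symm (v j)) = 0 := by
  have hgen : ∀ i, φ.symm (v i) ∈ (Submodule.span ℂ (Set.range v)).map φ.symm.toLinearMap :=
    fun i => ⟨v i, Submodule.subset_span ⟨i, rfl⟩, rfl⟩
  constructor
  · rintro ⟨h1, h2⟩
    refine ⟨fun i => ?_, fun i j => h2 _ (hgen i) _ (hgen j)⟩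
    obtain ⟨w, hw, hw'⟩ := h1 _ (hgen i)
    rw [← hw']
    simpa using hw
  · rintro ⟨h1, h2⟩
    constructor
    · rintro _ ⟨w, hw, rfl⟩
      refine ⟨φ (complexConj V (φ.symm w)), ?_, by simp⟩
      rw [SetLike.mem_coe] at hw ⊢
      induction hw using Submodule.span_induction with
      | zero => simp
      | add a b _ _ ha hb => simpa using Submodule.add_mem _ ha hb
      | smul z a _ ha =>
        rw [map_smul, complexConj_smul, map_smul]
        exact Submodule.smul_mem _ _ ha
      | mem a ha =>
        obtain ⟨i, rfl⟩ := ha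
        exact h1 i
    · rintro _ ⟨u, hu, rfl⟩ _ ⟨w, hw, rfl⟩
      rw [SetLike.mem_coe] at hu hw
      simp only [LinearEquiv.coe_coe]
      induction hu, hw using Submodule.span_induction₂ with
      | mem_mem a b ha hb =>
        obtain ⟨i, rfl⟩ := ha
        obtain ⟨j, rfl⟩ := hb
        exact h2 i j
      | zero_left => simp
      | zero_right => simp
      | add_left _ _ _ _ _ _ h h' => rw [map_add, map_add, LinearMap.add_apply, h, h', add_zero]
      | add_right _ _ _ _ _ _ h h' => rw [map_add, map_add, h, h', add_zero]
      | smul_left _ _ _ _ _ h => rw [map_smul, map_smul, LinearMap.smul_apply, h, smul_zero]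
      | smul_right _ _ _ _ _ h => rw [map_smul, map_smul, h, smul_zero]

/-- In the quotient topology, closedness is tested on frames. There isotropy is a system of
continuous equations, and stability under conjugation says that adjoining the conjugate of a frame
vector destroys independence, which is closed because independence is open. -/
theorem isClosed_setOf_isRealIsotropic_map_symm {V : Type*} [AddCommGroup V] [Module ℝ V]
    (Q : LinearMap.BilinForm ℝ V) (k : ℕ) {n : ℕ} (φ : (ℂ ⊗[ℝ] V) ≃ₗ[ℂ] (Fin n → ℂ)) :
    IsClosed {P : Gr k (Fin n → ℂ) | IsRealIsotropic Q (P.map φ.symm).1} := by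
  refine isClosed_coinduced.2 ?_
  let c : (Fin n → ℂ) →ₗ[ℝ] (Fin n → ℂ) :=
    φ.toLinearMap.restrictScalars ℝ ∘ₗ complexConj V ∘ₗ φ.symm.toLinearMap.restrictScalars ℝ
  have hc : Continuous c := c.continuous_of_finiteDimensional
  let q : LinearMap.BilinForm ℂ (Fin n → ℂ) :=
    (Q.baseChange ℂ).compl₁₂ φ.symm.toLinearMap φ.symm.toLinearMap
  have hq : Continuous fun p : (Fin n → ℂ) × (Fin n → ℂ) => q p.1 p.2 := by
    have h1 : ∀ p : (Fin n → ℂ) × (Fin n → ℂ), q p.1 p.2 =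
        LinearMap.toContinuousLinearMap
          (LinearMap.toContinuousLinearMap.toLinearMap ∘ₗ q) p.1 p.2 := fun _ => rfl
    simp only [h1]
    fun_prop
  have hset : Gr.ofFrame ⁻¹' {P : Gr k (Fin n → ℂ) | IsRealIsotropic Q (P.map φ.symm).1} =
      (⋂ i, {v | LinearIndependent ℂ (Fin.cons (c (v.1 i)) v.1 : Fin (k + 1) → Fin n → ℂ)}ᶜ) ∩
      ⋂ i, ⋂ j, {v | q (v.1 i) (v.1 j) = 0} := by
    ext v
    refine (isRealIsotropic_map_symm_span_range_iff φ v.1).trans ?_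
    simp only [Set.mem_inter_iff, Set.mem_iInter, Set.mem_compl_iff, Set.mem_ofPred_eq,
      linearIndependent_finCons, v.2, true_and, not_not]
    rfl
  rw [hset]
  clear hset
  clear_value c q
  have happ : ∀ i, Continuous fun v : {v : Fin k → Fin n → ℂ // LinearIndependent ℂ v} => v.1 i :=
    fun i => (continuous_apply i).comp continuous_subtype_val
  refine (isClosed_iInter fun i => ?_).inter (isClosed_iInter fun i => isClosed_iInter fun j => ?_)
  · have hcons : Continuous fun v : {v : Fin k → Fin n → ℂ // LinearIndependent ℂ v} =>
        (Fin.cons (c (v.1 i)) v.1 : Fin (k + 1) → Fin n → ℂ) :=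
      (hc.comp (happ i)).finCons continuous_subtype_val
    exact (isOpen_setOfPred_linearIndependent.preimage hcons).isClosed_compl
  · exact isClosed_eq (hq.comp ((happ i).prodMk (happ j))) continuous_const

namespace FlatStructure

section Rank

variable {X : Type*} [TopologicalSpace X] {n : ℕ} {E : X → Type*}
  [∀ x, AddCommGroup (E x)] [∀ x, Module ℝ (E x)] [∀ x, TopologicalSpace (E x)]
  [TopologicalSpace (TotalSpace (Fin n → ℝ) E)] [FiberBundle (Fin n → ℝ) E]
  [VectorBundle ℝ (Fin n → ℝ) E]

/-! ### Real isotropic planes in the Grassmann bundle -/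

theorem transportPlane_mem_realIsotropic {A : FlatStructure n E}
    {Q : ∀ x, LinearMap.BilinForm ℝ (E x)} {k : ℕ} {x y : X} {T : E x ≃ₗ[ℝ] E y}
    (hT : ∀ u v, Q y (T u) (T v) = Q x u v) {P : Gr k (ℂ ⊗[ℝ] E x)}
    (hP : (⟨x, P⟩ : A.GrBundle k) ∈ A.realIsotropic Q k) :
    A.transportPlane T P ∈ A.realIsotropic Q k := by
  refine ⟨?_, ?_⟩
  · rintro _ ⟨u, hu, rfl⟩
    exact ⟨_, hP.1 u hu, (complexConj_baseChange T.toLinearMap u).symm⟩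
  · rintro _ ⟨u, hu, rfl⟩ _ ⟨v, hv, rfl⟩
    exact (baseChange_bilinForm_baseChange (T := T.toLinearMap) hT u v).trans
      (hP.2 u hu v hv)

theorem isInvariant_realIsotropic {A : FlatStructure n E}
    {Q : ∀ x, LinearMap.BilinForm ℝ (E x)} (hQ : A.IsFlatForm Q) (k : ℕ) :
    A.IsInvariant (A.realIsotropic Q k) := by
  rintro P hP _ ⟨y, γ, T, hT, rfl⟩
  exact transportPlane_mem_realIsotropic (hT.apply_eq hQ) hP

theorem continuous_grParam (A : FlatStructure n E) (k : ℕ) (e : A.charts) :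
    Continuous (A.grParam k e) :=
  continuous_iSup_rng (i := e) continuous_coinduced_rng

theorem isClosed_iff_preimage_grParam (A : FlatStructure n E) {k : ℕ} {S : Set (A.GrBundle k)} :
    IsClosed S ↔ ∀ e : A.charts, IsClosed (A.grParam k e ⁻¹' S) := by
  rw [isClosed_iSup_iff]
  exact forall_congr' fun e => isClosed_coinduced

theorem finiteDimensional_fiber (A : FlatStructure n E) (x : X) : FiniteDimensional ℝ (E x) := by
  obtain ⟨e, he, hx⟩ := A.exists_chart x
  have := A.linear ⟨e, he⟩
  exact Module.Finite.equiv (e.linearEquivAt ℝ x hx).symm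

/-- The complex plane spanned by a real frame, given by its coordinates in a basis of `E x`. -/
noncomputable def realFrameSpan (A : FlatStructure n E) {ι : Type*} [Fintype ι] {k : ℕ} {x : X}
    (b : Module.Basis ι ℝ (E x)) (f : {f : Fin k → ι → ℝ // LinearIndependent ℝ f}) :
    A.GrBundle k :=
  ⟨x, Gr.ofFrame ⟨fun i => (1 : ℂ) ⊗ₜ[ℝ] b.equivFun.symm (f.1 i),
    Module.Flat.linearIndependent_one_tmul
      (f.2.map' b.equivFun.symm.toLinearMap b.equivFun.symm.ker)⟩⟩

/-- In a flat chart at `x`, the frame of ℂⁿ depends on the real coordinates through a linear map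
between finite-dimensional spaces. -/
theorem continuous_realFrameSpan (A : FlatStructure n E) {ι : Type*} [Fintype ι] {k : ℕ} {x : X}
    (b : Module.Basis ι ℝ (E x)) : Continuous (A.realFrameSpan (k := k) b) := by
  obtain ⟨e, he, hx⟩ := A.exists_chart x
  let φ := A.complexFrame ⟨e, he⟩ x hx
  let ψ : (ι → ℝ) →ₗ[ℝ] (Fin n → ℂ) :=
    φ.toLinearMap.restrictScalars ℝ ∘ₗ TensorProduct.mk ℝ ℂ (E x) 1 ∘ₗ b.equivFun.symm.toLinearMap
  have hψ : Continuous ψ := ψ.continuous_of_finiteDimensional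
  have hli : ∀ f : {f : Fin k → ι → ℝ // LinearIndependent ℝ f},
      LinearIndependent ℂ fun i => ψ (f.1 i) := fun f =>
    (Module.Flat.linearIndependent_one_tmul (S := ℂ)
      (f.2.map' b.equivFun.symm.toLinearMap b.equivFun.symm.ker)).map' φ.toLinearMap φ.ker
  have h1 : Continuous fun f : {f : Fin k → ι → ℝ // LinearIndependent ℝ f} =>
      A.grParam k ⟨e, he⟩ (⟨x, hx⟩, Gr.ofFrame ⟨fun i => ψ (f.1 i), hli f⟩) := by
    refine (A.continuous_grParam k ⟨e, he⟩).comp (Continuous.prodMk continuous_const ?_)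
    refine Gr.continuous_ofFrame.comp (Continuous.subtype_mk ?_ _)
    exact continuous_pi fun i => hψ.comp ((continuous_apply i).comp continuous_subtype_val)
  refine h1.congr fun f => ?_
  have h2 : (Gr.ofFrame ⟨fun i => ψ (f.1 i), hli f⟩).map φ.symm =
      (A.realFrameSpan (k := k) b f).2 := by
    refine Subtype.ext ?_
    change (Submodule.span ℂ _).map φ.symm.toLinearMap = Submodule.span ℂ _
    rw [Submodule.map_span, ← Set.range_comp]
    congr 2
    ext i
    exact φ.symm_apply_apply ((1 : ℂ) ⊗ₜ[ℝ] b.equivFun.symm (f.1 i))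
  exact congrArg (Sigma.mk x) h2

/-- In a flat trivialization, the planes of `ℂⁿ` that correspond to real isotropic planes do not
depend on the base point as long as the coefficients of the form do not. -/
theorem grParam_mem_realIsotropic {A : FlatStructure n E}
    {Q : ∀ x, LinearMap.BilinForm ℝ (E x)} {k : ℕ} (e : A.charts) {x y : e.1.baseSet}
    (h : ∀ u v, Q y (e.1.symm y u) (e.1.symm y v) = Q x (e.1.symm x u) (e.1.symm x v))
    {P : Gr k (Fin n → ℂ)} (hP : A.grParam k e (x, P) ∈ A.realIsotropic Q k) :
    A.grParam k e (y, P) ∈ A.realIsotropic Q k := by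
  -- The map that is the identity in the coordinates of `e`: it preserves the form by `h` and
  -- carries the plane over `x` to the plane over `y`.
  let T : E x ≃ₗ[ℝ] E y := (e.1.linearEquivAt ℝ x x.2).trans (e.1.linearEquivAt ℝ y y.2).symm
  have hT : ∀ u v, Q y (T u) (T v) = Q x u v := fun u v => by
    have h1 := h (e.1.linearEquivAt ℝ x x.2 u) (e.1.linearEquivAt ℝ x x.2 v)
    have h2 : ∀ u, e.1.symm x (e.1.linearEquivAt ℝ x x.2 u) = u := fun u =>
      (e.1.linearEquivAt ℝ x x.2).symm_apply_apply u
    rw [h2, h2] at h1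
    exact h1
  have hmap : ∀ z : ℂ ⊗[ℝ] E x,
      T.baseChange ℝ ℂ (E x) (E y) z = (A.complexFrame e y y.2).symm
        (A.complexFrame e x x.2 z) := fun z => by
    rw [LinearEquiv.eq_symm_apply]
    induction z with
    | zero => simp
    | add x y hx hy => simp only [map_add, hx, hy]
    | tmul c v =>
      change TensorProduct.piScalarRight ℝ ℂ ℂ (Fin n) (c ⊗ₜ e.1.linearEquivAt ℝ y y.2 (T v)) =
        TensorProduct.piScalarRight ℝ ℂ ℂ (Fin n) (c ⊗ₜ e.1.linearEquivAt ℝ x x.2 v)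
      simp [T]
  have heq : A.grParam k e (y, P) = A.transportPlane T (A.grParam k e (x, P)).2 := by
    refine congrArg (Sigma.mk (y : X)) (Subtype.ext ?_)
    change P.1.map _ = (P.1.map _).map _
    rw [← Submodule.map_comp]
    congr 1
    refine LinearMap.ext fun z => ?_
    change _ = T.baseChange ℝ ℂ (E x) (E y) ((A.complexFrame e x x.2).symm _)
    rw [hmap, LinearEquiv.apply_symm_apply]
    rfl
  rw [heq]
  exact transportPlane_mem_realIsotropic hT hP

theorem isClosed_setOf_grParam_mem_realIsotropic (A : FlatStructure n E)
    (Q : ∀ x, LinearMap.BilinForm ℝ (E x)) (k : ℕ) (e : A.charts) (x : e.1.baseSet) :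
    IsClosed {P : Gr k (Fin n → ℂ) | A.grParam k e (x, P) ∈ A.realIsotropic Q k} :=
  isClosed_setOf_isRealIsotropic_map_symm (Q x) k (A.complexFrame e x x.2)

/-- Since the form has locally constant coefficients, the condition in a flat chart is locally
independent of the base point, so a point of the complement has a product neighbourhood in it. -/
theorem isClosed_realIsotropic {A : FlatStructure n E}
    {Q : ∀ x, LinearMap.BilinForm ℝ (E x)} (hQ : A.IsFlatForm Q) (k : ℕ) :
    IsClosed (A.realIsotropic Q k) := by
  refine A.isClosed_iff_preimage_grParam.2 fun e => ⟨isOpen_iff_mem_nhds.2 ?_⟩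
  rintro ⟨x, P⟩ hP
  have h1 : ∀ᶠ y : e.1.baseSet in 𝓝 x, ∀ u v : Fin n → ℝ,
      Q y (e.1.symm y u) (e.1.symm y v) = Q x (e.1.symm x u) (e.1.symm x v) :=
    continuous_subtype_val.continuousAt.eventually (hQ e.1 e.2 x x.2)
  have h2 := (A.isClosed_setOf_grParam_mem_realIsotropic Q k e x).isOpen_compl.mem_nhds hP
  filter_upwards [prod_mem_nhds h1 h2] with ⟨y, R⟩ ⟨hy, hR⟩ hcon
  exact hR (grParam_mem_realIsotropic e (fun u v => (hy u v).symm) hcon)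

end Rank

end FlatStructure

/-! ### Rational vectors and the integral lattice -/

section RationalVectors

variable {V : Type*} [AddCommGroup V] [Module ℝ V] {ι : Type*} [Fintype ι]

theorem IsRationalVector.exists_smul_mem_span (b : Module.Basis ι ℝ V) {v : ι → ℝ}
    (hv : IsRationalVector v) :
    ∃ m : ℕ, m ≠ 0 ∧ (m : ℝ) • b.equivFun.symm v ∈ Submodule.span ℤ (Set.range b) := by
  obtain ⟨q, rfl⟩ := hv
  -- The product of the denominators clears all of them at once.
  refine ⟨∏ i, (q i).den, Finset.prod_ne_zero_iff.2 fun i _ => (q i).den_nz, ?_⟩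
  rw [Module.Basis.equivFun_symm_apply, Finset.smul_sum]
  refine Submodule.sum_mem _ fun i _ => ?_
  obtain ⟨d, hd⟩ := Finset.dvd_prod_of_mem (fun i => (q i).den) (Finset.mem_univ i)
  have h1 : ((∏ i, (q i).den : ℕ) : ℝ) * (q i : ℝ) = ((d * (q i).num : ℤ) : ℝ) := by
    have h2 : (q i) * (q i).den = (q i).num := Rat.mul_den_eq_num (q i)
    have h3 : ((q i : ℚ) : ℝ) * ((q i).den : ℝ) = ((q i).num : ℝ) := by exact_mod_cast h2
    rw [hd]
    push_cast
    rw [← h3]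
    ring
  rw [smul_smul, h1, Int.cast_smul_eq_zsmul]
  exact Submodule.smul_mem _ _ (Submodule.subset_span ⟨i, rfl⟩)

theorem IsSymplecticBasis.exists_rat {Q : LinearMap.BilinForm ℝ V}
    {b : Module.Basis (Fin 2 ⊕ Fin 2) ℝ V} (hb : IsSymplecticBasis Q b) {v w}
    (hv : IsRationalVector v) (hw : IsRationalVector w) :
    ∃ q : ℚ, Q (b.equivFun.symm v) (b.equivFun.symm w) = q := by
  obtain ⟨k, hk, hk'⟩ := hv.exists_smul_mem_span b
  obtain ⟨l, hl, hl'⟩ := hw.exists_smul_mem_span b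
  obtain ⟨z, hz⟩ := hb.exists_int_of_mem_span hk' hl'
  refine ⟨z / (k * l), ?_⟩
  simp only [map_smul, LinearMap.smul_apply, smul_eq_mul] at hz
  push_cast
  rw [← hz]
  have : (k : ℝ) ≠ 0 := by exact_mod_cast hk
  have : (l : ℝ) ≠ 0 := by exact_mod_cast hl
  field_simp

end RationalVectors

/-! ### Density of monodromy orbits in the fibres -/

namespace FlatStructure

section RankFour

variable {X : Type*} [TopologicalSpace X] {E : X → Type*}
  [∀ x, AddCommGroup (E x)] [∀ x, Module ℝ (E x)] [∀ x, TopologicalSpace (E x)]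
  [TopologicalSpace (TotalSpace (Fin 4 → ℝ) E)] [FiberBundle (Fin 4 → ℝ) E]
  [VectorBundle ℝ (Fin 4 → ℝ) E]

/-- The coordinates of the pairs of vectors of `E x` that span a plane in the monodromy orbit of
`P`. -/
def orbitFrames (A : FlatStructure 4 E) {ι : Type*} [Fintype ι] {x : X}
    (b : Module.Basis ι ℝ (E x)) (P : Gr 2 (ℂ ⊗[ℝ] E x)) : Set ((ι → ℝ) × (ι → ℝ)) :=
  {p | LinearIndependent ℝ ![b.equivFun.symm p.1, b.equivFun.symm p.2] ∧
    ∃ T ∈ A.monodromyGroup x, P.1.map (T.toLinearMap.baseChange ℂ) =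
      complexSpan (b.equivFun.symm p.1) (b.equivFun.symm p.2)}

/-- A change of basis does not alter the spanned plane, and being continuous on pairs it passes to
the closure. -/
theorem isChangeOfBasisInvariant_closure_orbitFrames (A : FlatStructure 4 E) {ι : Type*}
    [Fintype ι] {x : X} (b : Module.Basis ι ℝ (E x)) (P : Gr 2 (ℂ ⊗[ℝ] E x)) :
    IsChangeOfBasisInvariant (closure (A.orbitFrames b P)) := by
  intro a c hac p q r s hpq
  have hcont : Continuous fun y : (ι → ℝ) × (ι → ℝ) =>
      (p • y.1 + q • y.2, r • y.1 + s • y.2) := by fun_prop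
  refine (map_mem_closure (t := A.orbitFrames b P) hcont hac ?_ :)
  rintro ⟨a, c⟩ ⟨hli, T, hT, h⟩
  refine ⟨?_, T, hT, ?_⟩
  · simp only [map_add, map_smul]
    exact (LinearIndependent.pair_add_smul_add_smul_iff _ _ _ _).2 ⟨hli, hpq⟩
  · simp only [map_add, map_smul]
    rw [h, complexSpan_changeOfBasis hli hpq]

theorem isTransvectionInvariant_closure_orbitFrames (A : FlatStructure 4 E) {x : X}
    {Q : LinearMap.BilinForm ℝ (E x)} {ι : Type*} [Fintype ι] (b : Module.Basis ι ℝ (E x))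
    (hΓ : ∀ v ∈ Submodule.span ℤ (Set.range b), ∃ N : ℕ, N ≠ 0 ∧ ∀ k : ℕ,
      ∃ T ∈ A.monodromyGroup x, ∀ u, T u = u + (k * N * Q v u) • v)
    (P : Gr 2 (ℂ ⊗[ℝ] E x)) :
    IsTransvectionInvariant (Q.compl₁₂ b.equivFun.symm.toLinearMap b.equivFun.symm.toLinearMap)
      (closure (A.orbitFrames b P)) := by
  intro v hv
  obtain ⟨m, hm, hmv⟩ := hv.exists_smul_mem_span b
  obtain ⟨N, hN, hT⟩ := hΓ _ hmv
  -- The group contains powers of the transvection along the lattice vector m v, and k N Q(m v, u) m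
  -- v = k N m² Q(v, u) v.
  refine ⟨N * m ^ 2, by positivity, fun k a c hac => ?_⟩
  obtain ⟨T, hTΓ, hTu⟩ := hT k
  have hTb : ∀ a : ι → ℝ, b.equivFun.symm (a + (k * (N * m ^ 2 : ℝ) *
      Q.compl₁₂ b.equivFun.symm.toLinearMap b.equivFun.symm.toLinearMap v a) • v) =
      T (b.equivFun.symm a) := fun a => by
    rw [hTu]
    simp only [map_add, map_smul, LinearMap.compl₁₂_apply, LinearEquiv.coe_coe,
      LinearMap.smul_apply, smul_eq_mul, smul_smul]
    ring_nf
  have hcont : ∀ f : (ι → ℝ) →ₗ[ℝ] ℝ, Continuous f := fun f => f.continuous_of_finiteDimensional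
  have hcont' : Continuous fun y : (ι → ℝ) × (ι → ℝ) =>
      (y.1 + (k * (N * m ^ 2 : ℝ) *
        Q.compl₁₂ b.equivFun.symm.toLinearMap b.equivFun.symm.toLinearMap v y.1) • v,
      y.2 + (k * (N * m ^ 2 : ℝ) *
        Q.compl₁₂ b.equivFun.symm.toLinearMap b.equivFun.symm.toLinearMap v y.2) • v) := by
    have h1 := (hcont (Q.compl₁₂ b.equivFun.symm.toLinearMap b.equivFun.symm.toLinearMap v)).comp
      (continuous_fst (X := ι → ℝ) (Y := ι → ℝ))
    have h2 := (hcont (Q.compl₁₂ b.equivFun.symm.toLinearMap b.equivFun.symm.toLinearMap v)).comp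
      (continuous_snd (X := ι → ℝ) (Y := ι → ℝ))
    exact (continuous_fst.add ((continuous_const.mul h1).smul continuous_const)).prodMk
      (continuous_snd.add ((continuous_const.mul h2).smul continuous_const))
  refine (map_mem_closure (t := A.orbitFrames b P) hcont' hac ?_ :)
  rintro ⟨a, c⟩ ⟨hli, S, hS, h⟩
  refine ⟨?_, T * S, mul_mem hTΓ hS, ?_⟩
  · simp only [hTb]
    exact hli.pair_map T
  · simp only [hTb]
    have h1 : ((T * S : E x ≃ₗ[ℝ] E x).toLinearMap).baseChange ℂ =
        (T.toLinearMap.baseChange ℂ) ∘ₗ (S.toLinearMap.baseChange ℂ) :=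
      LinearMap.baseChange_comp _ _
    rw [h1, Submodule.map_comp, h, map_complexSpan]
    rfl

/-- If the monodromy group at `x` contains powers of all integral transvections, the monodromy
orbit of a real Lagrangian plane is dense among the real Lagrangian planes. -/
theorem mem_closure_monodromyOrbit (A : FlatStructure 4 E)
    {Q : ∀ x, LinearMap.BilinForm ℝ (E x)} {x : X} (halt : (Q x).IsAlt)
    (hnd : (Q x).Nondegenerate)
    {b : Module.Basis (Fin 2 ⊕ Fin 2) ℝ (E x)} (hb : IsSymplecticBasis (Q x) b)
    (hΓ : ∀ v ∈ Submodule.span ℤ (Set.range b), ∃ N : ℕ, N ≠ 0 ∧ ∀ k : ℕ,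
      ∃ T ∈ A.monodromyGroup x, ∀ u, T u = u + (k * N * Q x v u) • v)
    {P R : Gr 2 (ℂ ⊗[ℝ] E x)}
    (hP : (⟨x, P⟩ : A.GrBundle 2) ∈ A.realIsotropic Q 2)
    (hR : (⟨x, R⟩ : A.GrBundle 2) ∈ A.realIsotropic Q 2) :
    (⟨x, R⟩ : A.GrBundle 2) ∈ closure (A.monodromyOrbit P) := by
  have := A.finiteDimensional_fiber x
  have hbasis : ∀ S : Gr 2 (ℂ ⊗[ℝ] E x), (⟨x, S⟩ : A.GrBundle 2) ∈ A.realIsotropic Q 2 →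
      ∃ a c : Fin 2 ⊕ Fin 2 → ℝ, LinearIndependent ℝ ![b.equivFun.symm a, b.equivFun.symm c] ∧
        LinearIndependent ℝ ![a, c] ∧
        S.1 = complexSpan (b.equivFun.symm a) (b.equivFun.symm c) ∧
        Q x (b.equivFun.symm a) (b.equivFun.symm c) = 0 := by
    intro S hS
    obtain ⟨a, c, hli, h⟩ := exists_eq_complexSpan S.2 hS.1
    refine ⟨b.equivFun a, b.equivFun c, ?_⟩
    simp only [LinearEquiv.symm_apply_apply]
    refine ⟨hli, hli.pair_map b.equivFun, h, ?_⟩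
    · have h1 := hS.2 ((1 : ℂ) ⊗ₜ a) (h ▸ Submodule.subset_span (by simp)) ((1 : ℂ) ⊗ₜ c)
        (h ▸ Submodule.subset_span (by simp))
      simpa using h1
  obtain ⟨a, c, hli, hli', hPac, hac⟩ := hbasis P hP
  obtain ⟨v, w, hvw, hvw', hRvw, hvw0⟩ := hbasis R hR
  -- The rational transvection argument, applied with the closure of the orbit frames as the closed
  -- set and a frame of `P` as its starting point.
  have hmem : (v, w) ∈ closure (A.orbitFrames b P) := by
    refine mem_of_isotropic (ω := (Q x).compl₁₂ b.equivFun.symm.toLinearMap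
      b.equivFun.symm.toLinearMap) (a := a) (b := c) (by simp) (fun u => halt _) ?_
      (fun _ _ hv hw => hb.exists_rat hv hw) isClosed_closure
      (A.isChangeOfBasisInvariant_closure_orbitFrames b P)
      (A.isTransvectionInvariant_closure_orbitFrames b hΓ P) ?_ hli' hac hvw' hvw0
    · exact hnd.congr b.equivFun
    · refine subset_closure ⟨hli, 1, one_mem _, ?_⟩
      rw [← hPac]
      have h1 : ((1 : E x ≃ₗ[ℝ] E x).toLinearMap).baseChange ℂ = LinearMap.id :=
        LinearMap.baseChange_id
      rw [h1, Submodule.map_id]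
  let f₀ : {f : Fin 2 → Fin 2 ⊕ Fin 2 → ℝ // LinearIndependent ℝ f} := ⟨![v, w], hvw'⟩
  have hspan : ∀ f : {f : Fin 2 → Fin 2 ⊕ Fin 2 → ℝ // LinearIndependent ℝ f},
      (A.realFrameSpan b f).2.1 =
        complexSpan (b.equivFun.symm (f.1 0)) (b.equivFun.symm (f.1 1)) := fun f => by
    rw [complexSpan_eq_span_range]
    change Submodule.span ℂ _ = _
    congr 2
    ext i
    fin_cases i <;> rfl
  -- The closure in the space of independent frames is computed in the ambient space of all pairs,
  -- so the frame of `R` is a limit of frames spanning planes of the orbit.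
  have hf₀ : f₀ ∈ closure (A.realFrameSpan (k := 2) b ⁻¹' A.monodromyOrbit P) := by
    rw [closure_subtype]
    have hcont : Continuous fun y : (Fin 2 ⊕ Fin 2 → ℝ) × (Fin 2 ⊕ Fin 2 → ℝ) => ![y.1, y.2] := by
      fun_prop
    refine (map_mem_closure (t := Subtype.val '' (A.realFrameSpan (k := 2) b ⁻¹'
      A.monodromyOrbit P)) hcont hmem ?_ :)
    rintro ⟨a', c'⟩ ⟨hli, T, hT, h⟩
    have hli' : LinearIndependent ℝ ![a', c'] := by
      simpa only [LinearEquiv.apply_symm_apply] using hli.pair_map b.equivFun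
    refine ⟨⟨![a', c'], hli'⟩, ⟨T, hT, congrArg (Sigma.mk x) (Subtype.ext ?_)⟩, rfl⟩
    exact (hspan ⟨![a', c'], hli'⟩).trans h.symm
  have hf₁ := map_mem_closure (A.continuous_realFrameSpan b) hf₀ (Set.mapsTo_preimage _ _)
  have heq : A.realFrameSpan b f₀ = ⟨x, R⟩ :=
    congrArg (Sigma.mk x) (Subtype.ext ((hspan f₀).trans hRvw.symm))
  rwa [heq] at hf₁

/-- A thick monodromy group contains, at every point, powers of all integral transvections. -/
theorem exists_transvection_mem_monodromyGroup (A : FlatStructure 4 E)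
    {Q : ∀ x, LinearMap.BilinForm ℝ (E x)} (hQ : A.IsFlatForm Q) {x₀ x : X}
    (halt : (Q x₀).IsAlt)
    {b : Module.Basis (Fin 2 ⊕ Fin 2) ℝ (E x₀)} (hb : IsSymplecticBasis (Q x₀) b)
    (hthick : ((A.monodromyGroup x₀).subgroupOf
      (integralSymplecticGroup (Q x₀) b)).FiniteIndex) {γ : Path x₀ x} {S : E x₀ ≃ₗ[ℝ] E x}
    (hS : A.IsParallelTransport γ S) :
    ∀ v ∈ Submodule.span ℤ (Set.range (b.map S)), ∃ N : ℕ, N ≠ 0 ∧ ∀ k : ℕ,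
      ∃ T ∈ A.monodromyGroup x, ∀ u, T u = u + (k * N * Q x v u) • v := by
  intro v hv
  have hv' : S.symm v ∈ Submodule.span ℤ (Set.range b) := by
    have h1 : Set.range (b.map S) = (S.toLinearMap.restrictScalars ℤ) '' Set.range b := by
      rw [← Set.range_comp]
      rfl
    rw [h1, ← Submodule.map_span] at hv
    obtain ⟨w, hw, rfl⟩ := hv
    simpa using hw
  -- Finite index forces some positive power of the integral transvection along `S.symm v` into the
  -- monodromy group at `x₀`.
  obtain ⟨N, hN, -, hmem⟩ := Subgroup.exists_pow_mem_of_relIndex_ne_zero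
    (H := A.monodromyGroup x₀) (K := integralSymplecticGroup (Q x₀) b) hthick.index_ne_zero
    (transvection_mem_integralSymplecticGroup halt hb hv')
  refine ⟨N, hN.ne', fun k => ?_⟩
  obtain ⟨δ, hδ⟩ := pow_mem hmem.1 k
  -- Conjugation by the transport `S` turns monodromy at `x₀` into monodromy at `x`, and the
  -- transvection along `S.symm v` into the one along `v`.
  refine ⟨_, ⟨_, (hS.symm.trans hδ).trans hS⟩, fun u => ?_⟩
  have h2 : Q x₀ (S.symm v) (S.symm u) = Q x v u := by
    have := hS.apply_eq hQ (S.symm v) (S.symm u)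
    simpa using this.symm
  simp only [LinearEquiv.trans_apply, ← pow_mul, pow_transvection_apply, map_add, map_smul,
    LinearEquiv.apply_symm_apply, h2]
  push_cast
  ring_nf

end RankFour

end FlatStructure

/-! ### Density and minimality -/

theorem mainTheorem12
    {B : Type*} [NormedAddCommGroup B] [NormedSpace ℂ B] [FiniteDimensional ℂ B]
    {X : Type*} [TopologicalSpace X] [ChartedSpace B X] [IsManifold 𝓘(ℂ, B) 1 X]
    [ConnectedSpace X]
    {E : X → Type*} [∀ x, AddCommGroup (E x)] [∀ x, Module ℝ (E x)]
    [∀ x, TopologicalSpace (E x)] [TopologicalSpace (TotalSpace (Fin 4 → ℝ) E)]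
    [FiberBundle (Fin 4 → ℝ) E] [VectorBundle ℝ (Fin 4 → ℝ) E]
    (A : FlatStructure 4 E) (𝓗 : RealHodgeFamily B A 3)
    (htype : ∀ x p, Module.finrank ℂ (𝓗.H x p) = 1)
    (x₀ : X) (b : Module.Basis (Fin 2 ⊕ Fin 2) ℝ (E x₀)) (hb : IsSymplecticBasis (𝓗.Q x₀) b)
    (hΓ : A.monodromyGroup x₀ ≤ integralSymplecticGroup (𝓗.Q x₀) b)
    (hthick : ((A.monodromyGroup x₀).subgroupOf
      (integralSymplecticGroup (𝓗.Q x₀) b)).FiniteIndex) :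
    (∀ (x : X) (P : Gr 2 (ℂ ⊗[ℝ] E x)),
      (⟨x, P⟩ : A.GrBundle 2) ∈ A.realIsotropic 𝓗.Q 2 →
        A.monodromyOrbit P ⊆ {R | R ∈ A.realIsotropic 𝓗.Q 2 ∧ R.1 = x} ∧
        {R | R ∈ A.realIsotropic 𝓗.Q 2 ∧ R.1 = x} ⊆ closure (A.monodromyOrbit P)) ∧
    IsClosed (A.realIsotropic 𝓗.Q 2) ∧ A.IsInvariant (A.realIsotropic 𝓗.Q 2) ∧
    ∀ S : Set (A.GrBundle 2), S ⊆ A.realIsotropic 𝓗.Q 2 → IsClosed S → A.IsInvariant S →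
      S.Nonempty → S = A.realIsotropic 𝓗.Q 2 := by
  -- Charts in a normed space give local path connectedness, which the existence of transport
  -- between any two points requires.
  have hlpc : LocallyPathConnectedSpace X := by
    have : NormedSpace ℝ B := NormedSpace.restrictScalars ℝ ℂ B
    have : LocallyPathConnectedSpace B := inferInstance
    exact ChartedSpace.locallyPathConnectedSpace B X
  have halt := 𝓗.alt (by decide)
  have hdense : ∀ (x : X) (P R : Gr 2 (ℂ ⊗[ℝ] E x)),
      (⟨x, P⟩ : A.GrBundle 2) ∈ A.realIsotropic 𝓗.Q 2 →
      (⟨x, R⟩ : A.GrBundle 2) ∈ A.realIsotropic 𝓗.Q 2 →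
      (⟨x, R⟩ : A.GrBundle 2) ∈ closure (A.monodromyOrbit P) := by
    intro x P R hP hR
    obtain ⟨γ, S, hS⟩ := A.exists_isParallelTransport x₀ x
    have hb' : IsSymplecticBasis (𝓗.Q x) (b.map S) := fun i j => by
      rw [Module.Basis.map_apply, Module.Basis.map_apply, hS.apply_eq 𝓗.flat, hb]
    exact A.mem_closure_monodromyOrbit (halt x) (𝓗.nondegenerate x) hb'
      (A.exists_transvection_mem_monodromyGroup 𝓗.flat (halt x₀) hb hthick hS) hP hR
  refine ⟨fun x P hP => ⟨?_, ?_⟩, A.isClosed_realIsotropic 𝓗.flat 2,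
    A.isInvariant_realIsotropic 𝓗.flat 2, fun S hSM hS hinv hne => hSM.antisymm ?_⟩
  · rintro _ ⟨T, ⟨γ, hT⟩, rfl⟩
    exact ⟨FlatStructure.transportPlane_mem_realIsotropic (hT.apply_eq 𝓗.flat) hP, rfl⟩
  · rintro ⟨y, R⟩ ⟨hR, rfl : y = x⟩
    exact hdense _ P R hP hR
  · rintro ⟨y, R⟩ hR
    obtain ⟨⟨x, P⟩, hP⟩ := hne
    obtain ⟨γ, T, hT⟩ := A.exists_isParallelTransport x y
    -- Invariance moves a point of `S` into the fibre of the target plane; its monodromy orbit stays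
    -- in the closed set `S` and is dense among the real isotropic planes of that fibre.
    have hP' : A.transportPlane T P ∈ S := hinv _ hP ⟨y, γ, T, hT, rfl⟩
    refine closure_minimal ?_ hS (hdense y _ R (hSM hP') hR)
    rintro _ ⟨T', ⟨δ, hT'⟩, rfl⟩
    exact hinv _ hP' ⟨y, δ, T', hT', rfl⟩
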